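/- Let $X=\{0,1\}^n$ be the vertex set of the hypercube $\mathcal Q_n$ with Hamming distance $\partial$, and let $A_j$ be the distance-$j$ matrix. On $V=\mathbb C^X$ let $E_i$ be the orthogonal projection onto the eigenspace of $A_1$ with eigenvalue $n-2i$ $(0\le i\le n)$. Fix $x\in X$, let $\hat x\in V$ be its characteristic vector, let $X_k=\{y\in X:\partial(x,y)=k\}$, and let $E_k^*$ be the diagonal $0/1$ matrix whose diagonal is the characteristic vector of $X_k$. A weighted subset $(Y,\omega)$ consists of $Y\subseteq X$ and $\omega:X\to[0,\infty)$ with $\omega(y)>0$ exactly when $y\in Y$; put $L=\{k:Y\cap X_k\neq\emptyset\}$. It is a relative $t$-design (with respect to $x$) if $E_i\omega\in\operatorname{span}\{E_i\hat x\}$ for $1\le i\le t$, and a relative $2e$-design is tight if $|Y|=\dim\big(\sum_{k\in L}E_k^*\big)\big(\sum_{i=0}^eE_iV\big)$. Let $(Y,\omega)$ be a tight relative $2e$-design with $L=\{\ell,m\}$, where $e\le\ell<m\le n-\ell$. For $a,b\in\{\ell,m\}$ put $Y_a=Y\cap X_a$, $S_{a,b}(Y)=\{\partial(y,z):y\in Y_a,\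 z\in Y_b\}$ and $\omega_a=\sum_{y\in Y_a}\omega(y)$. Let $\boldsymbol H\subseteq M_Y(\mathbb C)$ be the span of the matrices which, for some $a,b\in\{\ell,m\}$ and $j\in S_{a,b}(Y)$, agree with $A_j$ on $Y_a\times Y_b$ and vanish elsewhere. With $\binom n{-1}=0$ and $(c)_k=c(c+1)\cdots(c+k-1)$, define $$F_r^{i,j}(\xi)=\sum_{k=0}^r\frac{(-\xi)_k(-r)_k(r-n-1)_k}{(j-n)_k(-i)_k\,k!},\qquad \kappa_e=\frac{\omega_\ell\binom{n-2e}{\ell-e}}{2^{n-2e}\binom n\ell}+\frac{\omega_m\binom{n-2e}{m-e}}{2^{n-2e}\binom nm},$$ $$\psi_e^{a,a}(\xi)=\sum_{r=0}^{e-1}\Big(\tbinom nr-\tbinom n{r-1}\Big)F_r^{a,a}(\xi)+\frac{\omega_a\binom{n-2e}{a-e}\big(\binom ne-\binom n{e-1}\big)}{2^{n-2e}\kappa_e\binom na}F_e^{a,a}(\xi)\quad(a\in\{\ell,m\}),\qquad \psi_e^{\ell,m}(\xi)=F_e^{\ell,m}(\xi).$$ Then the following hold. (i) $\boldsymbol H$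 is a coherent algebra, i.e. a subalgebra of $M_Y(\mathbb C)$ that contains the all-ones matrix and is closed under the entrywise product and conjugate transposition. It is the span of the adjacency matrices of the relations of a coherent configuration on $Y$ whose fibers are $Y_\ell$ and $Y_m$ and whose type is $\left[\begin{smallmatrix}e+1&e\\e&e+1\end{smallmatrix}\right]$; that is, $e+1$ relations are contained in each of $Y_\ell\times Y_\ell$ and $Y_m\times Y_m$, and $e$ relations in each of $Y_\ell\times Y_m$ and $Y_m\times Y_\ell$. (ii) The polynomials $\psi_e^{\ell,\ell},\psi_e^{m,m},\psi_e^{\ell,m}$ have degree $e$, and their sets of complex zeros are respectively $$\{\xi\ne0:2\xi\in S_{\ell,\ell}(Y)\},\qquad\{\xi\ne0:2\xi\in S_{m,m}(Y)\},\qquad\{\xi:2\xi+m-\ell\in S_{\ell,m}(Y)\}.$$ In particular, all zeros of these polynomials are integers. -/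

import Mathlib

noncomputable section

/-! ### Coherent configurations and coherent algebras -/

/-- `R` is (the set of relations of) a coherent configuration on the finite set `X`. -/
structure IsCoherentConfiguration {X : Type*} [Fintype X] (R : Set (Set (X × X))) : Prop where
  /-- `R` is a partition of `X × X` into non-empty sets. -/
  isPartition : Setoid.IsPartition R
  /-- The diagonal is a union of members of `R`. -/
  diagonal : ∃ R₀ ⊆ R, ⋃₀ R₀ = Set.diagonal X
  /-- `R` is invariant under transposition. -/
  transpose : ∀ r ∈ R, Prod.swap ⁻¹' r ∈ R
  /-- The intersection numbers are well defined. -/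
  intersection : ∀ r ∈ R, ∀ s ∈ R, ∀ t ∈ R, ∃ p : ℕ, ∀ x y : X, (x, y) ∈ t →
    {z : X | (x, z) ∈ r ∧ (z, y) ∈ s}.ncard = p

open Classical in
/-- The adjacency matrix of a relation `r` on `X`. -/
def relationMatrix {X : Type*} (r : Set (X × X)) : Matrix X X ℂ :=
  Matrix.of fun x y => if (x, y) ∈ r then 1 else 0

/-- The linear span of the adjacency matrices of the relations in `R`. -/
def adjacencySpan {X : Type*} (R : Set (Set (X × X))) : Submodule ℂ (Matrix X X ℂ) :=
  Submodule.span ℂ (relationMatrix '' R)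

/-- The fibers of a coherent configuration: the sets `Φ` such that
`{(x, x) : x ∈ Φ}` is a relation. -/
def fibers {X : Type*} (R : Set (Set (X × X))) : Set (Set X) :=
  {Φ | (fun x => (x, x)) '' Φ ∈ R}

/-- `F 0, …, F (k - 1)` are precisely the fibers (without repetition) and, with respect to this
ordering of the fibers, the type of the configuration is the matrix `T`. -/
def HasType {X : Type*} (R : Set (Set (X × X))) {k : ℕ} (F : Fin k → Set X)
    (T : Matrix (Fin k) (Fin k) ℕ) : Prop :=
  Function.Injective F ∧ Set.range F = fibers R ∧
    ∀ i j, {r ∈ R | r ⊆ F i ×ˢ F j}.ncard = T i j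

/-- A linear space of complex matrices is a coherent algebra if it is a subalgebra of the full
matrix algebra that contains the all-ones matrix and is closed under the entrywise product and
under conjugate transposition. -/
def IsCoherentAlgebra {X : Type*} [Fintype X] [DecidableEq X]
    (H : Submodule ℂ (Matrix X X ℂ)) : Prop :=
  (∃ A : Subalgebra ℂ (Matrix X X ℂ), Subalgebra.toSubmodule A = H) ∧
    (Matrix.of fun _ _ => 1) ∈ H ∧
    (∀ M ∈ H, ∀ N ∈ H, Matrix.hadamard M N ∈ H) ∧
    (∀ M ∈ H, M.conjTranspose ∈ H)

/-! ### The hypercube -/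

/-- The vertex set `{0,1}ⁿ` of the hypercube. -/
abbrev Cube (n : ℕ) : Type := Fin n → Bool

/-- The standard module `ℂ^X` with its Hermitian inner product. -/
abbrev StdModule (n : ℕ) : Type := EuclideanSpace ℂ (Cube n)

/-- The distance-`j` matrix `A_j` of the hypercube. -/
def distMatrix (n j : ℕ) : Matrix (Cube n) (Cube n) ℂ :=
  Matrix.of fun y z => if hammingDist y z = j then 1 else 0

/-- The eigenspace of the adjacency matrix `A₁` with eigenvalue `θ_i = n - 2 i`, that is,
the space `E_i V` (it is zero for `i > n`). -/
def eigSpace (n i : ℕ) : Submodule ℂ (StdModule n) :=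
  Module.End.eigenspace (Matrix.toEuclideanLin (distMatrix n 1)) ((n : ℂ) - 2 * (i : ℂ))

/-- The primitive idempotent `E_i`: the orthogonal projection onto `E_i V`. -/
def primIdem (n i : ℕ) : StdModule n →L[ℂ] StdModule n :=
  (eigSpace n i).starProjection

/-- The dual idempotent `E_i^*` with respect to the base vertex `x`. -/
def dualIdem {n : ℕ} (x : Cube n) (i : ℕ) : Matrix (Cube n) (Cube n) ℂ :=
  Matrix.diagonal fun y => if hammingDist x y = i then 1 else 0

/-! ### Relative designs -/

/-- `(Y, ω)` is a weighted subset: `ω` is positive on `Y` and is extended by zero. -/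
def IsWeightedSubset {n : ℕ} (Y : Finset (Cube n)) (ω : Cube n → ℝ) : Prop :=
  (∀ y ∈ Y, 0 < ω y) ∧ ∀ y, y ∉ Y → ω y = 0

/-- The set `L` of the indices of the shells (with respect to `x`) which meet `Y`. -/
def shellIndices {n : ℕ} (x : Cube n) (Y : Finset (Cube n)) : Finset ℕ :=
  Y.image fun y => hammingDist x y

/-- The weighted subset `(Y, ω)` is a relative `t`-design with respect to `x`:
`E_i ω ∈ span {E_i x̂}` for `1 ≤ i ≤ t`. -/
def IsRelativeDesign {n : ℕ} (t : ℕ) (x : Cube n) (Y : Finset (Cube n)) (ω : Cube n → ℝ) : Prop :=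
  IsWeightedSubset Y ω ∧ ∀ i, 1 ≤ i → i ≤ t →
    primIdem n i (WithLp.toLp 2 fun y => (ω y : ℂ)) ∈
      Submodule.span ℂ {primIdem n i (EuclideanSpace.single x 1)}

/-- The relative `2e`-design `(Y, ω)` is tight:
`|Y| = dim (∑_{ℓ ∈ L} E_ℓ^*) (∑_{i=0}^e E_i V)`. -/
def IsTightRelativeDesign {n : ℕ} (e : ℕ) (x : Cube n) (Y : Finset (Cube n)) (ω : Cube n → ℝ) :
    Prop :=
  IsRelativeDesign (2 * e) x Y ω ∧
    Y.card = Module.finrank ℂ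
      (Submodule.map (Matrix.toEuclideanLin (∑ k ∈ shellIndices x Y, dualIdem x k))
        (⨆ i ∈ Finset.range (e + 1), eigSpace n i))

/-- The total weight `⟨ω, X̂_k⟩` of the shell `X_k`. -/
def shellWeight {n : ℕ} (x : Cube n) (ω : Cube n → ℝ) (k : ℕ) : ℝ :=
  ∑ y with hammingDist x y = k, ω y

/-- The subset `Y_k = Y ∩ X_k`, as a subset of `Y`. -/
def shellPart {n : ℕ} (x : Cube n) (Y : Finset (Cube n)) (k : ℕ) : Set Y :=
  {y | hammingDist x y.1 = k}

/-- The set `S_{a,b}(Y)` of the distances between vertices of `Y_a` and vertices of `Y_b`. -/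
def distSet {n : ℕ} (x : Cube n) (Y : Finset (Cube n)) (a b : ℕ) : Set ℕ :=
  {j | ∃ y ∈ shellPart x Y a, ∃ z ∈ shellPart x Y b, hammingDist y.1 z.1 = j}

open Classical in
/-- The `Y × Y` matrix whose `Y_a × Y_b` block is the restriction of `A_j` and whose remaining
entries are zero. -/
def distBlock {n : ℕ} (x : Cube n) (Y : Finset (Cube n)) (a b j : ℕ) : Matrix Y Y ℂ :=
  Matrix.of fun y z =>
    if y ∈ shellPart x Y a ∧ z ∈ shellPart x Y b then distMatrix n j y.1 z.1 else 0

/-- The span `H` of the restrictions of the distance matrices `A_j`, `j ∈ S_{a,b}(Y)`, to the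
blocks `Y_a × Y_b`, where `a, b ∈ {ℓ, m}`. -/
def blockSpan {n : ℕ} (x : Cube n) (Y : Finset (Cube n)) (l m : ℕ) : Submodule ℂ (Matrix Y Y ℂ) :=
  Submodule.span ℂ {M | ∃ a ∈ ({l, m} : Set ℕ), ∃ b ∈ ({l, m} : Set ℕ), ∃ j ∈ distSet x Y a b,
    M = distBlock x Y a b j}

/-! ### Hahn polynomials -/

/-- The polynomial `₃F₂(-ξ, -r, r-n-1; j-n, -i; 1)` in `ξ`. The hypergeometric series terminates
after the term of index `r`. -/
def hahnPoly (n r i j : ℕ) : Polynomial ℝ :=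
  ∑ k ∈ Finset.range (r + 1),
    Polynomial.C (((ascPochhammer ℝ k).eval (-(r : ℝ)) *
        (ascPochhammer ℝ k).eval ((r : ℝ) - n - 1)) /
      ((ascPochhammer ℝ k).eval ((j : ℝ) - n) * (ascPochhammer ℝ k).eval (-(i : ℝ)) *
        (k.factorial : ℝ))) *
    (ascPochhammer ℝ k).comp (-Polynomial.X)

/-- `binom n r - binom n (r-1)`, where `binom n (-1) = 0`. -/
def binomDiff (n r : ℕ) : ℝ :=
  (n.choose r : ℝ) - if r = 0 then 0 else (n.choose (r - 1) : ℝ)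

/-- The scalar `κ_e` for the total weights `wl`, `wm` of the shells `X_l`, `X_m`. -/
def kappa (n e l m : ℕ) (wl wm : ℝ) : ℝ :=
  wl * ((n - 2 * e).choose (l - e) : ℝ) / (2 ^ (n - 2 * e) * (n.choose l : ℝ)) +
    wm * ((n - 2 * e).choose (m - e) : ℝ) / (2 ^ (n - 2 * e) * (n.choose m : ℝ))

/-- The polynomial `ψ_e^{k,k}`, where `w` is the total weight of the shell `X_k` and `κ = κ_e`. -/
def psiDiag (n e k : ℕ) (w κ : ℝ) : Polynomial ℝ :=
  (∑ r ∈ Finset.range e, Polynomial.C (binomDiff n r) * hahnPoly n r k k) +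
    Polynomial.C (w * ((n - 2 * e).choose (k - e) : ℝ) * binomDiff n e /
      (2 ^ (n - 2 * e) * κ * (n.choose k : ℝ))) * hahnPoly n e k k

/-- The polynomial `ψ_e^{l,m}`. -/
def psiOff (n e l m : ℕ) : Polynomial ℝ := hahnPoly n e l m

/-- The set of complex zeros of a real polynomial. -/
def zeroSet (p : Polynomial ℝ) : Set ℂ := {ξ | Polynomial.aeval ξ p = 0}

end

/-!
A vertex `y` is encoded by the set `A y` of the coordinates in which it agrees with the base
vertex `x`, of size `n - k` if `y` lies on the shell `X_k`. For `y` and `z` on given shells the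
distance is an affine function of `ξ = |A z \ A y|`. The characters of the cube diagonalize `A₁`,
and testing the relative design condition on them shows that the total weight of the `y` with `T ⊆
A y` depends only on `|T|` for `|T| ≤ 2e` (`exists_sum_mul_indicator`). Since the index of the
shell is itself a function of degree one with two values, each shell separately is a `(2e -
1)`-design (`TwoShellDesign.sum_shell`).

Functions of degree at most `e` on the shells decompose into harmonic functions of degrees `r ≤
e`. The zonal harmonics, whose values are the Hahn polynomials `F_r^{i,j}(ξ)` up to scalars
(`upFun_zonal`), give kernels `Φ_r(y, z)`. By the design property these are, up to positive
scalars, orthogonal idempotents with respect to the weights: separately on each pair of shells for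
`r < e`, and only on both shells together for `r = e`. Their sum `K`, suitably scaled, is the
reproducing kernel of the functions of degree at most `e`. It is idempotent and its trace is
`choose n e + choose n (e - 1)`. On the other hand the functions of degree at most `e` on two
shells are spanned by `choose n e + choose n (e - 1)` indicators of subcubes (`finrank_le`), so
that tightness forces `|Y| ≤ tr K`, and therefore `K` is the identity
(`TwoShellDesign.reproducingKernel_eq`). Read off on the blocks, this says that `ψ_e^{a,a}` and
`ψ_e^{ℓ,m}` vanish at the values `ξ` of distinct points of `Y`, and that the weights are constant
on each shell.

Conversely a polynomial of degree less than `e` that vanishes at all these `ξ` is a combination of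
the `Φ_r`, `r < e`, and multiplying by the `Φ_s` shows that it is zero
(`TwoShellDesign.eq_zero_of_eval_eq_zero`). So there are exactly `e` values of `ξ` on each pair of
shells, they are all the zeros of the polynomials of degree `e`, and the numbers of relations
follow. By interpolation every function of `ξ` on a pair of shells is a combination of the `Φ_r`,
`r < e`, and the identity. As these multiply among themselves, the intersection numbers are well
defined (`TightTwoShellDesign.isBlockFunction_sum`).
-/

open Finset
open scoped Polynomial

namespace HypercubeDesign

/-! ### Harmonic functions on the subsets of fixed size -/

section Harmonic

variable {α : Type*} [Fintype α] [DecidableEq α]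

/-- A function `c` on the `r`-subsets is harmonic if for every `(r - 1)`-set its values on the
supersets of size `r` sum to zero. Values of `c` on sets of other sizes are irrelevant. -/
def IsHarmonic (r : ℕ) (c : Finset α → ℝ) : Prop :=
  ∀ S : Finset α, S.card + 1 = r → ∑ j ∈ Sᶜ, c (insert j S) = 0

lemma sum_insert_subset (S B : Finset α) :
    ∑ j ∈ Sᶜ, (if insert j S ⊆ B then (1 : ℝ) else 0) =
      ((B.card : ℝ) - S.card) * (if S ⊆ B then 1 else 0) := by
  by_cases hS : S ⊆ B
  · have h1 : ∀ j ∈ Sᶜ, (if insert j S ⊆ B then (1 : ℝ) else 0) =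
        if j ∈ B \ S then 1 else 0 := by
      intro j hj
      have hj' : j ∉ S := by simpa using hj
      simp [insert_subset_iff, hS, hj']
    have h2 : Sᶜ.filter (· ∈ B \ S) = B \ S := by ext j; simp
    rw [sum_congr rfl h1, ← sum_filter, sum_const, nsmul_eq_mul, h2, cast_card_sdiff hS,
      if_pos hS]
  · rw [sum_eq_zero, if_neg hS, mul_zero]
    exact fun j _ => if_neg fun hj => hS ((subset_insert _ _).trans hj)

/-- Each superset of `I` of size `r` contains `r - |I|` of the sets `insert j I`. -/
lemma sum_insert_superset (r : ℕ) (I : Finset α) (f : Finset α → ℝ) :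
    ∑ j ∈ Iᶜ, ∑ T ∈ powersetCard r univ with insert j I ⊆ T, f T =
      ((r : ℝ) - I.card) * ∑ T ∈ powersetCard r univ with I ⊆ T, f T := by
  simp_rw [sum_filter]
  rw [sum_comm, mul_sum]
  refine sum_congr rfl fun T hT => ?_
  have h := congrArg (· * f T) (sum_insert_subset I T)
  simp only [sum_mul, (mem_powersetCard.1 hT).2] at h
  simpa [mul_assoc, ite_mul] using h

/-- A harmonic function sums to zero over the supersets of every smaller set, not only of those
with `r - 1` elements. -/
lemma IsHarmonic.sum_superset_eq_zero {r : ℕ} {c : Finset α → ℝ} (hc : IsHarmonic r c)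
    {I : Finset α} (hI : I.card < r) :
    ∑ T ∈ powersetCard r univ with I ⊆ T, c T = 0 := by
  obtain ⟨d, hd⟩ : ∃ d, I.card + d + 1 = r := ⟨r - I.card - 1, by omega⟩
  clear hI
  have hpos : (r : ℝ) - I.card ≠ 0 := by
    rw [← hd]; push_cast
    have : (0:ℝ) < (d:ℝ) + 1 := by positivity
    linarith
  induction d generalizing I with
  | zero =>
    apply (mul_right_inj' hpos).1
    rw [← sum_insert_superset, mul_zero, ← hc I hd]
    refine sum_congr rfl fun j hj => ?_
    have hj' : j ∉ I := by simpa using hj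
    have hcard : (insert j I).card = r := by rw [card_insert_of_notMem hj']; omega
    have : ({T ∈ powersetCard r (univ : Finset α) | insert j I ⊆ T}) = {insert j I} := by
      ext T
      simp only [mem_filter, mem_powersetCard, subset_univ, true_and, mem_singleton]
      constructor
      · rintro ⟨h1, h2⟩
        exact (eq_of_subset_of_card_le h2 (by omega)).symm
      · rintro rfl
        exact ⟨hcard, Subset.rfl⟩
    rw [this, sum_singleton]
  | succ d ih =>
    apply (mul_right_inj' hpos).1
    rw [← sum_insert_superset, mul_zero]
    refine sum_eq_zero fun j hj => ?_
    have hj' : j ∉ I := by simpa using hj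
    have hcard : (insert j I).card + d + 1 = r := by rw [card_insert_of_notMem hj']; omega
    refine ih hcard ?_
    rw [← hcard]; push_cast
    have : (0:ℝ) < (d:ℝ) + 1 := by positivity
    linarith

lemma sum_choose_inter (s k : ℕ) (T : Finset α) (c : Finset α → ℝ) :
    ∑ U ∈ powersetCard s univ, ((T ∩ U).card.choose k : ℝ) * c U =
      ∑ I ∈ powersetCard k T, ∑ U ∈ powersetCard s univ with I ⊆ U, c U := by
  simp_rw [sum_filter]
  rw [sum_comm]
  refine sum_congr rfl fun U _ => ?_
  rw [← sum_filter, sum_const, nsmul_eq_mul]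
  congr 2
  rw [← card_powersetCard]
  congr 1
  ext I
  simp only [mem_powersetCard, mem_filter, subset_inter_iff]
  tauto

/-- The Gregory–Newton formula, with the sum extended to a range that does not depend on `x`. -/
lemma newton_expansion (g : ℕ → ℝ) {x s : ℕ} (hx : x ≤ s) :
    g x = ∑ k ∈ range (s + 1), (x.choose k : ℝ) * ((fwdDiff 1)^[k] g 0) := by
  have h := shift_eq_sum_fwdDiff_iter 1 g x 0
  simp only [zero_add, smul_eq_mul, mul_one, nsmul_eq_mul] at h
  rw [h]
  refine sum_subset (range_mono (by omega)) fun k _ hk => ?_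
  rw [Nat.choose_eq_zero_of_lt (by simpa using hk), Nat.cast_zero, zero_mul]

/-- Integrating a function of `|T ∩ U|` against a harmonic function of degree `s`: in the Newton
expansion `∑ₖ (Δᵏg)(0) * choose |T ∩ U| k` only the term `k = s` survives. -/
lemma IsHarmonic.sum_comp_card_inter {s : ℕ} {c : Finset α → ℝ} (hc : IsHarmonic s c)
    (g : ℕ → ℝ) (T : Finset α) :
    ∑ U ∈ powersetCard s univ, g (T ∩ U).card * c U =
      ((fwdDiff 1)^[s] g 0) * ∑ I ∈ powersetCard s T, c I := by
  have h1 : ∀ U ∈ powersetCard s (univ : Finset α), g (T ∩ U).card * c U =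
      ∑ k ∈ range (s + 1), ((fwdDiff 1)^[k] g 0) * (((T ∩ U).card.choose k : ℝ) * c U) := by
    intro U hU
    rw [mem_powersetCard] at hU
    rw [newton_expansion g (hU.2 ▸ card_le_card inter_subset_right), sum_mul]
    exact sum_congr rfl fun _ _ => by ring
  rw [sum_congr rfl h1, sum_comm]
  simp_rw [← mul_sum, sum_choose_inter]
  rw [sum_range_succ, sum_eq_zero, zero_add]
  · congr 1
    refine sum_congr rfl fun I hI => ?_
    rw [mem_powersetCard] at hI
    have : ({U ∈ powersetCard s (univ : Finset α) | I ⊆ U}) = {I} := by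
      ext U
      simp only [mem_filter, mem_powersetCard, subset_univ, true_and, mem_singleton]
      constructor
      · rintro ⟨h1, h2⟩
        exact (eq_of_subset_of_card_le h2 (by omega)).symm
      · rintro rfl
        exact ⟨hI.2, Subset.rfl⟩
    rw [this, sum_singleton]
  · intro k hk
    rw [sum_eq_zero, mul_zero]
    intro I hI
    rw [mem_powersetCard] at hI
    exact hc.sum_superset_eq_zero (by rw [hI.2]; simpa using hk)

/-- The function on all subsets `B` with the coefficients `c` on the indicator functions of the
conditions `T ⊆ B`, `|T| = r`. -/
def upFun (r : ℕ) (c : Finset α → ℝ) (B : Finset α) : ℝ := ∑ T ∈ powersetCard r B, c T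

lemma upFun_eq (r : ℕ) (c : Finset α → ℝ) (B : Finset α) :
    upFun r c B = ∑ T ∈ powersetCard r univ, c T * if T ⊆ B then 1 else 0 := by
  simp_rw [mul_ite, mul_one, mul_zero]
  rw [← sum_filter, upFun]
  congr 1
  ext T; simp [mem_powersetCard, and_comm]

/-- If the weighted number of blocks containing `T` depends only on `|T|`, for `|T| ≤ r + s`, then
the weighted inner product of a function of degree `r` with a harmonic one of degree `s` is a
finite difference of these numbers times the inner product of the coefficients. -/
lemma sum_upFun_mul_upFun {ι : Type*} (Y : Finset ι) (A : ι → Finset α) (w : ι → ℝ) (lam : ℕ → ℝ)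
    {r s : ℕ} (hlam : ∀ T : Finset α, T.card ≤ r + s →
      ∑ y ∈ Y, w y * (if T ⊆ A y then 1 else 0) = lam T.card)
    (c : Finset α → ℝ) {c' : Finset α → ℝ} (hc' : IsHarmonic s c') :
    ∑ y ∈ Y, w y * (upFun r c (A y) * upFun s c' (A y)) =
      ((fwdDiff 1)^[s] (fun k => lam (r + s - k)) 0) *
        ∑ T ∈ powersetCard r univ, c T * upFun s c' T := by
  have h1 : ∀ y, w y * (upFun r c (A y) * upFun s c' (A y)) =
      ∑ T ∈ powersetCard r univ, ∑ U ∈ powersetCard s univ,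
        c T * c' U * (w y * if T ∪ U ⊆ A y then 1 else 0) := by
    intro y
    rw [upFun_eq, upFun_eq, sum_mul_sum, mul_sum]
    refine sum_congr rfl fun T _ => ?_
    rw [mul_sum]
    refine sum_congr rfl fun U _ => ?_
    by_cases hT : T ⊆ A y <;> by_cases hU : U ⊆ A y <;> simp [hT, hU, union_subset_iff]
    ring
  simp_rw [h1]
  rw [sum_comm, mul_sum]
  refine sum_congr rfl fun T hT => ?_
  rw [mem_powersetCard] at hT
  rw [sum_comm]
  simp_rw [← mul_sum]
  have h2 : ∀ U ∈ powersetCard s (univ : Finset α),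
      c T * c' U * ∑ y ∈ Y, w y * (if T ∪ U ⊆ A y then (1:ℝ) else 0) =
      c T * (lam (r + s - (T ∩ U).card) * c' U) := by
    intro U hU
    rw [mem_powersetCard] at hU
    have hle : (T ∪ U).card ≤ r + s := by
      have := card_union_le T U; omega
    have : (T ∪ U).card = r + s - (T ∩ U).card := by
      have := card_union_add_card_inter T U; omega
    rw [hlam _ hle, this]; ring
  rw [sum_congr rfl h2, ← mul_sum, hc'.sum_comp_card_inter (fun k => lam (r + s - k)) T, upFun]
  ring

end Harmonic

/-! ### Zonal harmonics and Hahn polynomials -/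

/-- The Chu–Vandermonde identity `₂F₁(-s, c; b; 1) = (b - c)ₛ / (b)ₛ`. -/
lemma chu_vandermonde (s : ℕ) (b c : ℝ) (hb : ∀ j < s, b + j ≠ 0) :
    ∑ k ∈ range (s + 1), (-1 : ℝ) ^ k * (s.choose k : ℝ) *
        ((ascPochhammer ℝ k).eval c / (ascPochhammer ℝ k).eval b) =
      (ascPochhammer ℝ s).eval (b - c) / (ascPochhammer ℝ s).eval b := by
  induction s generalizing b with
  | zero => simp
  | succ s ih =>
    have hb0 : b ≠ 0 := by simpa using hb 0 (by omega)
    have hb1 : ∀ j < s, (b + 1) + j ≠ 0 := fun j hj => by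
      have := hb (j + 1) (by omega)
      push_cast at this; rwa [add_assoc, add_comm (1:ℝ)]
    have hleft : ∀ (k : ℕ) (t : ℝ), (ascPochhammer ℝ (k + 1)).eval t =
        t * (ascPochhammer ℝ k).eval (t + 1) := fun k t => by
      rw [ascPochhammer_succ_left]; simp
    have hne : ∀ k ≤ s + 1, (ascPochhammer ℝ k).eval b ≠ 0 := by
      intro k hk
      rw [Ne, ascPochhammer_eval_eq_zero_iff]
      rintro ⟨j, hj, h⟩
      exact hb j (by omega) (by linarith)
    have hne1 : ∀ k ≤ s, (ascPochhammer ℝ k).eval (b + 1) ≠ 0 := by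
      intro k hk
      rw [Ne, ascPochhammer_eval_eq_zero_iff]
      rintro ⟨j, hj, h⟩
      exact hb1 j (by omega) (by linarith)
    set f : ℕ → ℝ := fun k => (ascPochhammer ℝ k).eval c / (ascPochhammer ℝ k).eval b with hf
    have pascal : ∑ k ∈ range (s + 1 + 1), (-1 : ℝ) ^ k * ((s + 1).choose k : ℝ) * f k =
        ∑ k ∈ range (s + 1), (-1 : ℝ) ^ k * (s.choose k : ℝ) * (f k - f (k + 1)) := by
      rw [sum_range_succ']
      simp only [Nat.choose_succ_succ, Nat.cast_add, mul_sub, mul_add, add_mul, sum_sub_distrib,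
        sum_add_distrib]
      have e1 : ∑ k ∈ range (s + 1), (-1 : ℝ) ^ k * (s.choose k : ℝ) * f k =
          ∑ k ∈ range (s + 1), (-1 : ℝ) ^ (k + 1) * (s.choose (k + 1) : ℝ) * f (k + 1) + f 0 := by
        rw [sum_range_succ', sum_range_succ _ s]; simp
      rw [e1]
      simp only [pow_succ, mul_neg, mul_one, neg_mul, sum_neg_distrib, Nat.choose_zero_right,
        pow_zero, Nat.cast_one, one_mul]
      ring
    rw [pascal]
    have hterm : ∀ k ∈ range (s + 1), (-1 : ℝ) ^ k * (s.choose k : ℝ) * (f k - f (k + 1)) =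
        (b - c) / b * ((-1 : ℝ) ^ k * (s.choose k : ℝ) *
          ((ascPochhammer ℝ k).eval c / (ascPochhammer ℝ k).eval (b + 1))) := by
      intro k hk
      have hk' : k < s + 1 := by simpa using hk
      have h1 := hne k (by omega)
      have h2 := hne1 k (by omega)
      have h3 : b + k ≠ 0 := hb k hk'
      have h4 : (ascPochhammer ℝ k).eval b * (b + k) = b * (ascPochhammer ℝ k).eval (b + 1) := by
        rw [← hleft, ascPochhammer_succ_eval]
      simp only [hf, ascPochhammer_succ_eval]
      have : (ascPochhammer ℝ k).eval c / (ascPochhammer ℝ k).eval b -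
          (ascPochhammer ℝ k).eval c * (c + k) / ((ascPochhammer ℝ k).eval b * (b + k)) =
          (b - c) / b * ((ascPochhammer ℝ k).eval c / (ascPochhammer ℝ k).eval (b + 1)) := by
        have e : (ascPochhammer ℝ k).eval c / (ascPochhammer ℝ k).eval b -
          (ascPochhammer ℝ k).eval c * (c + k) / ((ascPochhammer ℝ k).eval b * (b + k)) =
          (b - c) * (ascPochhammer ℝ k).eval c / ((ascPochhammer ℝ k).eval b * (b + k)) := by
          field_simp; ring
        rw [e, h4, div_mul_div_comm]
      rw [this]; ring
    rw [sum_congr rfl hterm, ← mul_sum, ih (b + 1) hb1, hleft, hleft, div_mul_div_comm]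
    congr 3; ring

lemma ascPochhammer_eval_neg_natCast (x k : ℕ) :
    (ascPochhammer ℝ k).eval (-(x : ℝ)) = (-1) ^ k * ((k.factorial : ℝ) * x.choose k) := by
  rw [ascPochhammer_eval_neg_eq_descPochhammer, descPochhammer_eval_eq_descFactorial,
    Nat.descFactorial_eq_factorial_mul_choose, Nat.cast_mul]

/-- The coefficient `(r - n - 1)ₖ / (-i)ₖ` of the zonal harmonics and of the Hahn polynomials. -/
noncomputable def zonalCoeff (n r i k : ℕ) : ℝ :=
  (ascPochhammer ℝ k).eval ((r : ℝ) - n - 1) / (ascPochhammer ℝ k).eval (-(i : ℝ))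

lemma zonalCoeff_self {n r i : ℕ} (hr : r ≤ n) :
    zonalCoeff n r i r = ((n + 1 - r).choose r : ℝ) / (i.choose r : ℝ) := by
  have : (r : ℝ) - n - 1 = -((n + 1 - r : ℕ) : ℝ) := by
    rw [Nat.cast_sub (by omega)]; push_cast; ring
  rw [zonalCoeff, this, ascPochhammer_eval_neg_natCast, ascPochhammer_eval_neg_natCast]
  have h1 : ((-1 : ℝ)) ^ r ≠ 0 := by simp
  have h2 : (r.factorial : ℝ) ≠ 0 := by exact_mod_cast r.factorial_ne_zero
  rw [mul_div_mul_left _ _ h1, mul_div_mul_left _ _ h2]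

lemma zonalCoeff_self_pos {n r i : ℕ} (hr : 2 * r ≤ n) (hi : r ≤ i) :
    0 < zonalCoeff n r i r := by
  rw [zonalCoeff_self (by omega)]
  have h1 := Nat.choose_pos (n := n + 1 - r) (k := r) (by omega)
  have h2 := Nat.choose_pos hi
  positivity

/-- The zonal harmonic of degree `r` at a set `A` of size `n - i`: a function of the `r`-subsets `T`
that depends only on `|T \ A|`, normalized so that pairing with it is evaluation at `A`
(`IsHarmonic.sum_mul_zonal`). -/
noncomputable def zonal (n r i : ℕ) (A T : Finset (Fin n)) : ℝ :=
  (∑ k ∈ range (r + 1), (-1 : ℝ) ^ k * ((T \ A).card.choose k : ℝ) * zonalCoeff n r i k) /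
    zonalCoeff n r i r

/-- The closed form from which the recurrence expressing harmonicity is visible. -/
lemma sum_zonalCoeff {n r i s : ℕ} (hs : s ≤ r) (hi : r ≤ i) :
    ∑ k ∈ range (r + 1), (-1 : ℝ) ^ k * (s.choose k : ℝ) * zonalCoeff n r i k =
      (ascPochhammer ℝ s).eval ((n : ℝ) + 1 - i - r) / (ascPochhammer ℝ s).eval (-(i : ℝ)) := by
  have hb : ∀ j < s, -(i : ℝ) + j ≠ 0 := fun j hj => by
    have : (j : ℝ) < i := by exact_mod_cast (by omega : j < i)
    linarith
  have := chu_vandermonde s (-(i:ℝ)) ((r : ℝ) - n - 1) hb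
  rw [show -(i:ℝ) - ((r : ℝ) - n - 1) = (n : ℝ) + 1 - i - r by ring] at this
  rw [← this]
  symm
  refine sum_subset (range_mono (by omega)) fun k _ hk => ?_
  rw [Nat.choose_eq_zero_of_lt (by simpa using hk)]; simp

lemma zonal_eq {n r i : ℕ} (hi : r ≤ i) {A T : Finset (Fin n)} (hT : T.card = r) :
    zonal n r i A T = (ascPochhammer ℝ (T \ A).card).eval ((n : ℝ) + 1 - i - r) /
      (ascPochhammer ℝ (T \ A).card).eval (-(i : ℝ)) / zonalCoeff n r i r := by
  rw [zonal, sum_zonalCoeff (hT ▸ card_le_card sdiff_subset) hi]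

lemma isHarmonic_zonal {n r i : ℕ} (hi : r ≤ i) {A : Finset (Fin n)} (hA : A.card + i = n) :
    IsHarmonic r (zonal n r i A) := by
  intro S hS
  set s := (S \ A).card with hs
  have hsr : s ≤ S.card := card_le_card sdiff_subset
  have hins : ∀ j ∈ Sᶜ, (insert j S).card = r := fun j hj => by
    rw [card_insert_of_notMem (by simpa using hj), hS]
  set p : ℕ → ℝ := fun s => (ascPochhammer ℝ s).eval ((n : ℝ) + 1 - i - r) /
      (ascPochhammer ℝ s).eval (-(i : ℝ)) / zonalCoeff n r i r with hp
  have h1 : ∀ j ∈ Sᶜ, zonal n r i A (insert j S) = if j ∈ A then p s else p (s + 1) := by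
    intro j hj
    have hjS : j ∉ S := by simpa using hj
    rw [zonal_eq hi (hins j hj)]
    split_ifs with h
    · rw [insert_sdiff_of_mem _ h]
    · rw [insert_sdiff_of_notMem _ h, card_insert_of_notMem (by simp [hjS])]
  rw [sum_congr rfl h1, sum_ite, sum_const, sum_const, nsmul_eq_mul, nsmul_eq_mul]
  have c1 : (Sᶜ.filter (· ∈ A)).card + (S ∩ A).card = A.card := by
    have : Sᶜ.filter (· ∈ A) = A \ S := by ext; simp [and_comm]
    rw [this, inter_comm, card_sdiff_add_card_inter]
  have c2 : (Sᶜ.filter (· ∉ A)).card + s = i := by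
    have e1 : Sᶜ.filter (· ∉ A) = Aᶜ \ S := by ext; simp [and_comm]
    have e2 : S \ A = Aᶜ ∩ S := by ext; simp [and_comm]
    rw [e1, hs, e2, card_sdiff_add_card_inter, card_compl, Fintype.card_fin]; omega
  have c3 : s + (S ∩ A).card = S.card := card_sdiff_add_card_inter _ _
  have d1 : ((Sᶜ.filter (· ∈ A)).card : ℝ) = (n : ℝ) + 1 - i - r + s := by
    have : (Sᶜ.filter (· ∈ A)).card + i + r = n + 1 + s := by omega
    have := congrArg (Nat.cast : ℕ → ℝ) this
    push_cast at this; linarith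
  have d2 : ((Sᶜ.filter (· ∉ A)).card : ℝ) = (i : ℝ) - s := by
    have := congrArg (Nat.cast : ℕ → ℝ) c2
    push_cast at this; linarith
  rw [d1, d2]
  simp only [hp, ascPochhammer_succ_eval]
  have hne : (ascPochhammer ℝ s).eval (-(i:ℝ)) ≠ 0 := by
    rw [Ne, ascPochhammer_eval_eq_zero_iff]
    rintro ⟨j, hj, h⟩
    have : j = i := by exact_mod_cast (by linarith : (j:ℝ) = i)
    omega
  have hne2 : -(i:ℝ) + s ≠ 0 := by
    have : (s : ℝ) < i := by exact_mod_cast (by omega : s < i)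
    linarith
  field_simp
  ring

lemma sum_choose_card_sdiff {n : ℕ} (A B : Finset (Fin n)) {r k : ℕ} (hk : k ≤ r) :
    ∑ T ∈ powersetCard r B, ((T \ A).card.choose k : ℝ) =
      ((B \ A).card.choose k : ℝ) * ((B.card - k).choose (r - k) : ℝ) := by
  have h1 : ∀ T ∈ powersetCard r B, ((T \ A).card.choose k : ℝ) =
      ∑ K ∈ powersetCard k (B \ A), if K ⊆ T then (1:ℝ) else 0 := by
    intro T hT
    rw [mem_powersetCard] at hT
    rw [← sum_filter, sum_const, nsmul_eq_mul, mul_one, ← card_powersetCard]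
    congr 2
    ext K
    simp only [mem_powersetCard, mem_filter, subset_sdiff]
    constructor
    · rintro ⟨⟨a, b⟩, c⟩; exact ⟨⟨⟨a.trans hT.1, b⟩, c⟩, a⟩
    · rintro ⟨⟨⟨_, b⟩, c⟩, a⟩; exact ⟨⟨a, b⟩, c⟩
  rw [sum_congr rfl h1, sum_comm]
  have h2 : ∀ K ∈ powersetCard k (B \ A), ∑ T ∈ powersetCard r B, (if K ⊆ T then (1:ℝ) else 0) =
      ((B.card - k).choose (r - k) : ℝ) := by
    intro K hK
    rw [mem_powersetCard] at hK
    rw [← sum_filter, sum_const, nsmul_eq_mul, mul_one,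
      card_filter_powersetCard_subset _ _ _ (hK.1.trans sdiff_subset) (by omega), hK.2]
  rw [sum_congr rfl h2, sum_const, card_powersetCard, nsmul_eq_mul]

lemma choose_mul_eval_hahnPoly {n r i j : ℕ} (hjn : j ≤ n) (hr : r ≤ n - j) (x : ℕ) :
    ((n - j).choose r : ℝ) * (hahnPoly n r i j).eval (x : ℝ) =
      ∑ k ∈ range (r + 1), (-1 : ℝ) ^ k * ((x.choose k : ℝ) *
        ((n - j - k).choose (r - k) : ℝ)) * zonalCoeff n r i k := by
  rw [hahnPoly, Polynomial.eval_finsetSum, mul_sum]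
  refine sum_congr rfl fun k hk => ?_
  have hk' : k ≤ r := by simpa [Nat.lt_succ_iff] using hk
  have hN : (j : ℝ) - n = -((n - j : ℕ) : ℝ) := by rw [Nat.cast_sub hjn]; ring
  simp only [Polynomial.eval_mul, Polynomial.eval_C, Polynomial.eval_comp, Polynomial.eval_neg,
    Polynomial.eval_X, hN, zonalCoeff]
  rw [ascPochhammer_eval_neg_natCast x, ascPochhammer_eval_neg_natCast r,
    ascPochhammer_eval_neg_natCast (n - j)]
  have e : ((n - j).choose r : ℝ) * (r.choose k : ℝ) =
      ((n - j).choose k : ℝ) * ((n - j - k).choose (r - k) : ℝ) := by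
    exact_mod_cast Nat.choose_mul hk'
  have hk0 : (k.factorial : ℝ) ≠ 0 := by exact_mod_cast k.factorial_ne_zero
  have hc0 : ((n - j).choose k : ℝ) ≠ 0 := by
    exact_mod_cast (Nat.choose_pos (hk'.trans hr)).ne'
  have hs : ((-1 : ℝ)) ^ k ≠ 0 := by simp
  generalize (ascPochhammer ℝ k).eval (-(i:ℝ)) = D
  have e' : ((n - j - k).choose (r - k) : ℝ) =
      ((n - j).choose r : ℝ) * (r.choose k : ℝ) / ((n - j).choose k : ℝ) := by
    rw [e]; field_simp
  rw [e']
  rcases eq_or_ne D 0 with rfl | hD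
  · simp
  · field_simp

/-- The zonal harmonic, evaluated at sets `B` of size `n - j`, is a multiple of the Hahn polynomial
in `|B \ A|`. -/
lemma upFun_zonal {n r i j : ℕ} {A B : Finset (Fin n)} (hB : B.card + j = n) (hr : r ≤ n - j) :
    upFun r (zonal n r i A) B =
      ((n - j).choose r : ℝ) / zonalCoeff n r i r *
        (hahnPoly n r i j).eval ((B \ A).card : ℝ) := by
  rw [div_mul_eq_mul_div, choose_mul_eval_hahnPoly (by omega) hr]
  simp only [upFun, zonal]
  rw [← sum_div, sum_comm]
  congr 1
  refine sum_congr rfl fun k hk => ?_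
  have hk' : k ≤ r := by simpa [Nat.lt_succ_iff] using hk
  rw [← sum_mul, ← mul_sum, sum_choose_card_sdiff A B hk', show B.card = n - j by omega]

/-- The zonal harmonic at `B` represents evaluation at `B` on the harmonic functions. -/
lemma IsHarmonic.sum_mul_zonal {n r j : ℕ} {c : Finset (Fin n) → ℝ} (hc : IsHarmonic r c)
    (hr : 2 * r ≤ n) (hj : r ≤ j) (B : Finset (Fin n)) :
    ∑ T ∈ powersetCard r univ, c T * zonal n r j B T = upFun r c B := by
  set p : ℕ → ℝ := fun s => (ascPochhammer ℝ s).eval ((n : ℝ) + 1 - j - r) /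
      (ascPochhammer ℝ s).eval (-(j : ℝ)) with hp
  have hq := zonalCoeff_self_pos hr hj
  have h1 : ∀ T ∈ powersetCard r (univ : Finset (Fin n)), c T * zonal n r j B T =
      (fun x => p (r - x) / zonalCoeff n r j r) (B ∩ T).card * c T := by
    intro T hT
    rw [mem_powersetCard] at hT
    have : (T \ B).card = r - (B ∩ T).card := by
      rw [inter_comm]
      have := card_sdiff_add_card_inter T B
      omega
    rw [zonal_eq hj hT.2, this]
    ring
  rw [sum_congr rfl h1, hc.sum_comp_card_inter (fun x => p (r - x) / zonalCoeff n r j r)]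
  suffices h : (fwdDiff 1)^[r] (fun x => p (r - x) / zonalCoeff n r j r) 0 = 1 by
    rw [h, one_mul]; rfl
  -- the `r`-th difference at `0` is a Chu–Vandermonde sum, equal to the normalizing constant
  rw [fwdDiff_iter_eq_sum_shift, ← sum_range_reflect]
  have hb : ∀ t < r, -(j : ℝ) + t ≠ 0 := fun t ht => by
    have : (t : ℝ) < j := by exact_mod_cast (by omega : t < j)
    linarith
  have hCV := chu_vandermonde r (-(j:ℝ)) ((n : ℝ) + 1 - j - r) hb
  rw [show -(j:ℝ) - ((n : ℝ) + 1 - j - r) = r - n - 1 by ring] at hCV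
  have h2 : ∀ k ∈ range (r + 1), ((-1 : ℤ) ^ (r - (r + 1 - 1 - k)) *
      (r.choose (r + 1 - 1 - k) : ℤ)) • (p (r - (0 + (r + 1 - 1 - k) • 1)) / zonalCoeff n r j r) =
      ((-1 : ℝ) ^ k * (r.choose k : ℝ) * p k) / zonalCoeff n r j r := by
    intro k hk
    have hk' : k ≤ r := by simpa [Nat.lt_succ_iff] using hk
    have e1 : r - (r + 1 - 1 - k) = k := by omega
    have e2 : r - (0 + (r + 1 - 1 - k) • 1) = k := by simp; omega
    rw [e1, e2, show r + 1 - 1 - k = r - k by omega, Nat.choose_symm hk', zsmul_eq_mul]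
    push_cast; ring
  rw [sum_congr rfl h2, ← sum_div, hCV]
  exact div_self hq.ne'

lemma binomDiff_mul {n r : ℕ} (hr : 2 * r ≤ n) :
    binomDiff n r * ((n + 1 - r).choose r : ℝ) = (n.choose r : ℝ) * ((n - r).choose r : ℝ) := by
  have h1 : binomDiff n r * (n + 1 - r : ℝ) = (n.choose r : ℝ) * (n + 1 - 2 * r) := by
    rw [binomDiff]
    rcases Nat.eq_zero_or_pos r with rfl | hpos
    · simp
    · obtain ⟨s, rfl⟩ : ∃ s, r = s + 1 := ⟨r - 1, by omega⟩
      have := Nat.choose_succ_right_eq n s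
      have h := congrArg (Nat.cast : ℕ → ℝ) this
      rw [Nat.cast_mul, Nat.cast_mul, Nat.cast_sub (by omega)] at h
      simp only [Nat.succ_ne_zero, if_false, Nat.add_sub_cancel]
      push_cast at h ⊢
      linear_combination h
  have h2 : ((n - r).choose r : ℝ) * (n + 1 - r) =
      ((n + 1 - r).choose r : ℝ) * (n + 1 - 2 * r) := by
    have := Nat.choose_mul_succ_eq (n - r) r
    have h := congrArg (Nat.cast : ℕ → ℝ) this
    rw [show n - r + 1 - r = n + 1 - 2 * r by omega, show n - r + 1 = n + 1 - r by omega,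
      Nat.cast_mul, Nat.cast_mul, Nat.cast_sub (by omega), Nat.cast_sub (by omega)] at h
    push_cast at h; exact h
  have h3 : (n + 1 - r : ℝ) ≠ 0 := by
    have : (r : ℝ) ≤ n := by exact_mod_cast (by omega : r ≤ n)
    linarith
  apply mul_right_cancel₀ h3
  linear_combination ((n + 1 - r).choose r : ℝ) * h1 - (n.choose r : ℝ) * h2

lemma binomDiff_pos {n r : ℕ} (hr : 2 * r ≤ n) : 0 < binomDiff n r := by
  have h := binomDiff_mul hr
  have h1 : 0 < ((n + 1 - r).choose r : ℝ) := by exact_mod_cast Nat.choose_pos (by omega)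
  have h2 : 0 < (n.choose r : ℝ) := by exact_mod_cast Nat.choose_pos (by omega)
  have h3 : 0 < ((n - r).choose r : ℝ) := by exact_mod_cast Nat.choose_pos (by omega)
  exact pos_of_mul_pos_left (h ▸ mul_pos h2 h3) h1.le

lemma choose_mul_choose_mul_choose {n a r : ℕ} (hra : r ≤ a) (han : a + r ≤ n) :
    n.choose a * (n - a).choose r * a.choose r =
      n.choose r * (n - r).choose r * (n - 2 * r).choose (a - r) := by
  -- both sides count the triples of disjoint sets of sizes `r`, `r`, `a - r`
  have e1 : n.choose a * a.choose r = n.choose r * (n - r).choose (a - r) := Nat.choose_mul hra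
  have e2 : (n - r).choose (n - a) * (n - a).choose r =
      (n - r).choose r * (n - r - r).choose (n - a - r) := Nat.choose_mul (by omega)
  rw [← Nat.choose_symm_of_eq_add (show n - r = (a - r) + (n - a) by omega),
    ← Nat.choose_symm_of_eq_add (show n - r - r = (a - r) + (n - a - r) by omega)] at e2
  rw [show n - 2 * r = n - r - r by omega]
  calc _ = n.choose a * a.choose r * (n - a).choose r := by ring
    _ = n.choose r * ((n - r).choose (a - r) * (n - a).choose r) := by rw [e1]; ring
    _ = _ := by rw [e2]; ring

/-- The diagonal value of the zonal kernel on the shell `X_a` is its dimension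
`choose n r - choose n (r - 1)` times `choose (n - 2 * r) (a - r) / choose n a`. -/
lemma choose_div_zonalCoeff {n a r : ℕ} (hra : r ≤ a) (han : a + r ≤ n) :
    ((n - a).choose r : ℝ) / zonalCoeff n r a r * n.choose a =
      binomDiff n r * ((n - 2 * r).choose (a - r) : ℝ) := by
  rw [zonalCoeff_self (by omega)]
  have h1 : ((n + 1 - r).choose r : ℝ) ≠ 0 := by exact_mod_cast (Nat.choose_pos (by omega)).ne'
  have h2 : (a.choose r : ℝ) ≠ 0 := by exact_mod_cast (Nat.choose_pos hra).ne'
  have h3 := congrArg (Nat.cast : ℕ → ℝ) (choose_mul_choose_mul_choose hra han)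
  push_cast at h3
  have h4 := binomDiff_mul (show 2 * r ≤ n by omega)
  field_simp
  linear_combination h3 - ((n - 2 * r).choose (a - r) : ℝ) * h4

/-! ### Designs on two shells -/

lemma hahnPoly_eval_zero (n r i j : ℕ) : (hahnPoly n r i j).eval 0 = 1 := by
  rw [hahnPoly, Polynomial.eval_finsetSum, sum_range_succ']
  rw [sum_eq_zero]
  · simp
  · intro k _
    simp only [Polynomial.eval_mul, Polynomial.eval_C, Polynomial.eval_comp, Polynomial.eval_neg,
      Polynomial.eval_X, neg_zero]
    rw [ascPochhammer_ne_zero_eval_zero ℝ (Nat.succ_ne_zero k), mul_zero]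

lemma fwdDiff_iter_choose_add (N r j x : ℕ) :
    (fwdDiff 1)^[r] (fun k => ((N + k).choose (r + j) : ℝ)) x = ((N + x).choose j : ℝ) := by
  induction r generalizing j x with
  | zero => simp
  | succ r ih =>
    have := fun y => ih (j + 1) y
    rw [Function.iterate_succ_apply', fwdDiff]
    simp only [show r + 1 + j = r + (j + 1) by ring, this]
    rw [← add_assoc, Nat.choose_succ_succ]
    push_cast; ring

lemma fwdDiff_iter_congr {f g : ℕ → ℝ} {s : ℕ} (h : ∀ k ≤ s, f k = g k) :
    (fwdDiff 1)^[s] f 0 = (fwdDiff 1)^[s] g 0 := by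
  rw [fwdDiff_iter_eq_sum_shift, fwdDiff_iter_eq_sum_shift]
  refine sum_congr rfl fun k hk => ?_
  rw [h]
  simpa [Nat.lt_succ_iff] using hk

/-- Both sides count the pairs of disjoint sets of sizes `t` and `a`. -/
lemma choose_mul_choose_sub (n t a : ℕ) :
    n.choose t * (n - t).choose a = n.choose a * (n - a).choose t := by
  rcases le_or_gt (a + t) n with h | h
  · have e1 : n.choose (a + t) * (a + t).choose t = n.choose t * (n - t).choose (a + t - t) :=
      Nat.choose_mul (by omega)
    have e2 : n.choose (a + t) * (a + t).choose a = n.choose a * (n - a).choose (a + t - a) :=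
      Nat.choose_mul (by omega)
    rw [Nat.add_sub_cancel] at e1
    rw [Nat.add_sub_cancel_left] at e2
    rw [← e1, ← e2, ← Nat.choose_symm_of_eq_add (show a + t = t + a by omega)]
  · rcases lt_or_ge n t with h1 | h1
    · rw [Nat.choose_eq_zero_of_lt h1, Nat.choose_eq_zero_of_lt (show n - a < t by omega)]; simp
    · rcases lt_or_ge n a with h2 | h2
      · rw [Nat.choose_eq_zero_of_lt h2, Nat.choose_eq_zero_of_lt (show n - t < a by omega)]; simp
      · rw [Nat.choose_eq_zero_of_lt (show n - a < t by omega),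
          Nat.choose_eq_zero_of_lt (show n - t < a by omega)]; simp

/-- If the weighted number of blocks containing a `t`-set is constant, then double counting
determines the constant. -/
lemma choose_mul_eq_sum {n t : ℕ} {ι : Type*} (Y : Finset ι) (A : ι → Finset (Fin n)) (w : ι → ℝ)
    (μ : ℝ) (h : ∀ T : Finset (Fin n), T.card = t →
      ∑ y ∈ Y, w y * (if T ⊆ A y then 1 else 0) = μ) :
    (n.choose t : ℝ) * μ = ∑ y ∈ Y, w y * ((A y).card.choose t : ℝ) := by
  have h1 : ∑ T ∈ powersetCard t (univ : Finset (Fin n)),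
      ∑ y ∈ Y, w y * (if T ⊆ A y then 1 else 0) = (n.choose t : ℝ) * μ := by
    rw [sum_congr rfl fun T hT => h T (mem_powersetCard.1 hT).2, sum_const, card_powersetCard,
      card_univ, Fintype.card_fin, nsmul_eq_mul]
  rw [← h1, sum_comm]
  refine sum_congr rfl fun y _ => ?_
  rw [← mul_sum, ← sum_filter, sum_const, nsmul_eq_mul, mul_one, ← card_powersetCard]
  congr 3
  ext T; simp [mem_powersetCard, and_comm]

/-- A weighted `2e`-design on the shells of index `l` and `m`, in terms of sets of coordinates: the
point `y` corresponds to the set `A y` of size `n - k y`, has weight `w y`, and the total weight of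
the points with `T ⊆ A y` depends only on `|T|` as long as `|T| ≤ 2e`. -/
structure TwoShellDesign (n e l m : ℕ) {ι : Type*} [Fintype ι] (A : ι → Finset (Fin n))
    (k : ι → ℕ) (w : ι → ℝ) : Prop where
  le_l : e ≤ l
  l_lt_m : l < m
  add_le : m + l ≤ n
  pos : ∀ y, 0 < w y
  card_add : ∀ y, (A y).card + k y = n
  shell : ∀ y, k y = l ∨ k y = m
  nonempty_l : ∃ y, k y = l
  nonempty_m : ∃ y, k y = m
  design : ∃ lam : ℕ → ℝ, ∀ T : Finset (Fin n), T.card ≤ 2 * e →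
    ∑ y, w y * (if T ⊆ A y then 1 else 0) = lam T.card

/-- The total weight of the shell of index `a`. -/
noncomputable def totalWeight {ι : Type*} [Fintype ι] (k : ι → ℕ) (w : ι → ℝ) (a : ℕ) : ℝ :=
  ∑ y with k y = a, w y

/-- The factor by which the inner product of harmonic coefficients of degree `r` has to be
multiplied to give the inner product of the functions on the shell of index `a`. -/
noncomputable def theta (n : ℕ) {ι : Type*} [Fintype ι] (k : ι → ℕ) (w : ι → ℝ) (a r : ℕ) : ℝ :=
  totalWeight k w a * ((n - 2 * r).choose (a - r) : ℝ) / (n.choose a : ℝ)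

/-- The kernel of degree `r`: the value at `z` of the zonal harmonic at `y`. -/
noncomputable def zonalKernel {n : ℕ} {ι : Type*} (A : ι → Finset (Fin n)) (k : ι → ℕ) (r : ℕ)
    (y z : ι) : ℝ :=
  upFun r (zonal n r (k y) (A y)) (A z)

lemma upFun_of_card_lt {n r : ℕ} (c : Finset (Fin n) → ℝ) {T : Finset (Fin n)} (h : T.card < r) :
    upFun r c T = 0 := by
  rw [upFun, powersetCard_eq_empty.2 h, sum_empty]

lemma upFun_of_card_eq {n r : ℕ} (c : Finset (Fin n) → ℝ) {T : Finset (Fin n)} (h : T.card = r) :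
    upFun r c T = c T := by
  subst h
  rw [upFun, powersetCard_self, sum_singleton]

/-- The `r`-th difference of the moments `W * choose (n - t) a / choose n a`, at `t = 2 * r - k`. -/
lemma fwdDiff_iter_shell_moment {n a r : ℕ} (W : ℝ) (hra : r ≤ a) (hrn : 2 * r ≤ n) :
    (fwdDiff 1)^[r] (fun k => W * ((n - (r + r - k)).choose a : ℝ) / (n.choose a : ℝ)) 0 =
      W * ((n - 2 * r).choose (a - r) : ℝ) / (n.choose a : ℝ) := by
  have h1 : ∀ k ≤ r, W * ((n - (r + r - k)).choose a : ℝ) / (n.choose a : ℝ) =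
      ((W / (n.choose a : ℝ)) • fun k => (((n - 2 * r) + k).choose (r + (a - r)) : ℝ)) k := by
    intro k hk
    simp only [Pi.smul_apply, smul_eq_mul]
    rw [show n - (r + r - k) = n - 2 * r + k by omega, show r + (a - r) = a by omega]
    ring
  rw [fwdDiff_iter_congr h1, fwdDiff_iter_const_smul, Pi.smul_apply, fwdDiff_iter_choose_add]
  simp only [smul_eq_mul, add_zero]
  ring

namespace TwoShellDesign

variable {n e l m : ℕ} {ι : Type*} [Fintype ι] {A : ι → Finset (Fin n)} {k : ι → ℕ} {w : ι → ℝ}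

lemma le_k (h : TwoShellDesign n e l m A k w) (y : ι) : e ≤ k y := by
  have := h.le_l; have := h.l_lt_m
  rcases h.shell y with h | h <;> omega

lemma k_add_le (h : TwoShellDesign n e l m A k w) (y : ι) : k y + e ≤ n := by
  have := h.le_l; have := h.l_lt_m; have := h.add_le
  rcases h.shell y with h | h <;> omega

lemma two_mul_lt (h : TwoShellDesign n e l m A k w) : 2 * e < n := by
  have := h.le_l; have := h.l_lt_m; have := h.add_le
  omega

lemma totalWeight_pos (h : TwoShellDesign n e l m A k w) (y : ι) : 0 < totalWeight k w (k y) :=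
  sum_pos (fun z _ => h.pos z) ⟨y, by simp⟩

lemma theta_pos (h : TwoShellDesign n e l m A k w) (y : ι) {r : ℕ} (hr : r ≤ e) :
    0 < theta n k w (k y) r := by
  have h1 := h.totalWeight_pos y
  have h2 := h.le_k y
  have h3 := h.k_add_le y
  have h4 := Nat.choose_pos (n := n) (k := k y) (by omega)
  have h5 := Nat.choose_pos (n := n - 2 * r) (k := k y - r) (by omega)
  rw [theta]
  positivity

lemma sum_shells (h : TwoShellDesign n e l m A k w) (f : ι → ℝ) :
    ∑ y, f y = ∑ y with k y = l, f y + ∑ y with k y = m, f y := by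
  rw [← sum_filter_add_sum_filter_not univ (fun y => k y = l)]
  congr 1
  refine sum_congr ?_ fun _ _ => rfl
  ext y
  have := h.l_lt_m
  rcases h.shell y with hy | hy <;> simp [hy] <;> omega

lemma sum_insert (h : TwoShellDesign n e l m A k w) (T : Finset (Fin n)) :
    ∑ j ∈ Tᶜ, ∑ y, w y * (if insert j T ⊆ A y then 1 else 0) =
      ∑ y, ((n : ℝ) - k y - T.card) * (w y * (if T ⊆ A y then 1 else 0)) := by
  rw [sum_comm]
  refine sum_congr rfl fun y _ => ?_
  have h1 := congrArg (Nat.cast : ℕ → ℝ) (h.card_add y)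
  push_cast at h1
  rw [← mul_sum, sum_insert_subset, ← h1]
  ring

lemma eq_of_sum_eq {t a : ℕ} (h : TwoShellDesign n e l m A k w) (y₀ : ι) (ha : k y₀ = a)
    (ht : t ≤ n) {μ : ℝ}
    (hμ : ∀ T : Finset (Fin n), T.card = t →
      ∑ y with k y = a, w y * (if T ⊆ A y then 1 else 0) = μ) :
    μ = totalWeight k w a * ((n - t).choose a : ℝ) / (n.choose a : ℝ) := by
  have h1 := choose_mul_eq_sum _ A w μ hμ
  have h2 : ∀ y ∈ ({y | k y = a} : Finset ι), w y * ((A y).card.choose t : ℝ) =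
      w y * ((n - a).choose t : ℝ) := by
    intro y hy
    have hy' : k y = a := by simpa using hy
    rw [← hy', show n - k y = (A y).card by have := h.card_add y; omega]
  rw [sum_congr rfl h2, ← sum_mul] at h1
  have h3 := congrArg (Nat.cast : ℕ → ℝ) (choose_mul_choose_sub n t a)
  push_cast at h3
  have h4 : (n.choose t : ℝ) ≠ 0 := by exact_mod_cast (Nat.choose_pos ht).ne'
  have h5 : (n.choose a : ℝ) ≠ 0 := by
    have := h.card_add y₀
    exact_mod_cast (Nat.choose_pos (by omega)).ne'
  rw [eq_div_iff h5]
  apply mul_left_cancel₀ h4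
  rw [totalWeight]
  linear_combination (n.choose a : ℝ) * h1 - (∑ y with k y = a, w y) * h3

/-- Each shell by itself is a `(2e - 1)`-design: the two shell sums are determined by their sum and
by the sum weighted with `n - k y`, which counts incidences with `(|T| + 1)`-sets. -/
lemma sum_shell (h : TwoShellDesign n e l m A k w) (y₀ : ι) (T : Finset (Fin n))
    (hT : T.card + 1 ≤ 2 * e) :
    ∑ y with k y = k y₀, w y * (if T ⊆ A y then 1 else 0) =
      totalWeight k w (k y₀) * ((n - T.card).choose (k y₀) : ℝ) / (n.choose (k y₀) : ℝ) := by
  obtain ⟨lam, hlam⟩ := h.design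
  have hlt : (l : ℝ) < m := by exact_mod_cast h.l_lt_m
  have hn := h.two_mul_lt
  have key : ∀ S : Finset (Fin n), S.card = T.card →
      (∑ y with k y = l, w y * (if S ⊆ A y then 1 else 0) =
        (((n : ℝ) - T.card) * lam (T.card + 1) - (n - m - T.card) * lam T.card) / (m - l)) ∧
      (∑ y with k y = m, w y * (if S ⊆ A y then 1 else 0) =
        (((n : ℝ) - T.card) * lam (T.card + 1) - (n - l - T.card) * lam T.card) / (l - m)) := by
    intro S hS
    have e1 := hlam S (by omega)
    have e2 := h.sum_insert S
    have e3 : ∀ j ∈ Sᶜ, ∑ y, w y * (if insert j S ⊆ A y then (1:ℝ) else 0) =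
        lam (T.card + 1) := by
      intro j hj
      have : (insert j S).card = T.card + 1 := by
        rw [card_insert_of_notMem (by simpa using hj), hS]
      rw [← this]
      exact hlam _ (by omega)
    rw [sum_congr rfl e3, sum_const, card_compl, Fintype.card_fin, nsmul_eq_mul,
      Nat.cast_sub (by omega), h.sum_shells] at e2
    rw [h.sum_shells, hS] at e1
    have e4 : ∀ a, ∑ y with k y = a, ((n : ℝ) - k y - S.card) *
        (w y * (if S ⊆ A y then 1 else 0)) =
        (n - a - T.card) * ∑ y with k y = a, (w y * (if S ⊆ A y then 1 else 0)) := by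
      intro a
      rw [mul_sum]
      refine sum_congr rfl fun y hy => ?_
      have hy' : k y = a := by simpa using hy
      rw [hy', hS]
    rw [e4, e4, hS] at e2
    constructor
    · rw [eq_div_iff (by linarith)]
      linear_combination (-(n - m - T.card : ℝ)) * e1 - e2
    · rw [eq_div_iff (by linarith)]
      linear_combination (-(n - l - T.card : ℝ)) * e1 - e2
  rcases h.shell y₀ with hy | hy
  · rw [hy, (key T rfl).1]
    exact h.eq_of_sum_eq y₀ hy (by omega) fun S hS => (key S hS).1
  · rw [hy, (key T rfl).2]
    exact h.eq_of_sum_eq y₀ hy (by omega) fun S hS => (key S hS).2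

/-- On the whole design the moments are known up to degree `2e`. -/
lemma sum_all (h : TwoShellDesign n e l m A k w) (T : Finset (Fin n))
    (hT : T.card ≤ 2 * e) :
    ∑ y, w y * (if T ⊆ A y then 1 else 0) =
      totalWeight k w l * ((n - T.card).choose l : ℝ) / (n.choose l : ℝ) +
      totalWeight k w m * ((n - T.card).choose m : ℝ) / (n.choose m : ℝ) := by
  obtain ⟨lam, hlam⟩ := h.design
  have hn := h.two_mul_lt
  have hlt := h.l_lt_m
  have hadd := h.add_le
  set t := T.card with ht
  have h1 := choose_mul_eq_sum (t := t) univ A w (lam t) (fun S hS => by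
    have := hlam S (by omega)
    rwa [hS] at this)
  rw [h.sum_shells] at h1
  have h2 : ∀ a, ∑ y with k y = a, w y * ((A y).card.choose t : ℝ) =
      totalWeight k w a * ((n - a).choose t : ℝ) := by
    intro a
    rw [totalWeight, sum_mul]
    refine sum_congr rfl fun y hy => ?_
    have hy' : k y = a := by simpa using hy
    rw [← hy', show n - k y = (A y).card by have := h.card_add y; omega]
  rw [h2, h2] at h1
  have h3 := fun a => congrArg (Nat.cast : ℕ → ℝ) (choose_mul_choose_sub n t a)
  push_cast at h3
  have h4 : (n.choose t : ℝ) ≠ 0 := by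
    exact_mod_cast (Nat.choose_pos (by omega)).ne'
  have h5 : ∀ a ≤ n, (n.choose a : ℝ) ≠ 0 := fun a ha => by
    exact_mod_cast (Nat.choose_pos ha).ne'
  have h6 : ∀ a ≤ n, totalWeight k w a * ((n - a).choose t : ℝ) =
      n.choose t * (totalWeight k w a * ((n - t).choose a : ℝ) / (n.choose a : ℝ)) := by
    intro a ha
    have := h5 a ha
    field_simp
    linear_combination (- totalWeight k w a) * h3 a
  rw [hlam T hT]
  apply mul_left_cancel₀ h4
  rw [h1, h6 l (by omega), h6 m (by omega)]
  ring

lemma shell_inner_of_lt (h : TwoShellDesign n e l m A k w) (y₀ : ι) {r s : ℕ}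
    (hrs : r + s + 1 ≤ 2 * e) (hlt : r < s)
    (c : Finset (Fin n) → ℝ) {c' : Finset (Fin n) → ℝ} (hc' : IsHarmonic s c') :
    ∑ y with k y = k y₀, w y * (upFun r c (A y) * upFun s c' (A y)) = 0 := by
  rw [sum_upFun_mul_upFun _ A w (fun t => totalWeight k w (k y₀) *
      ((n - t).choose (k y₀) : ℝ) / (n.choose (k y₀) : ℝ))
    (fun T hT => h.sum_shell y₀ T (by omega)) c hc', sum_eq_zero, mul_zero]
  intro T hT
  rw [upFun_of_card_lt _ (by rw [(mem_powersetCard.1 hT).2]; exact hlt), mul_zero]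

lemma shell_inner_of_ne (h : TwoShellDesign n e l m A k w) (y₀ : ι) {r s : ℕ}
    (hrs : r + s + 1 ≤ 2 * e) (hne : r ≠ s)
    {c c' : Finset (Fin n) → ℝ} (hc : IsHarmonic r c) (hc' : IsHarmonic s c') :
    ∑ y with k y = k y₀, w y * (upFun r c (A y) * upFun s c' (A y)) = 0 := by
  rcases lt_or_gt_of_ne hne with hlt | hlt
  · exact h.shell_inner_of_lt y₀ hrs hlt c hc'
  · rw [← h.shell_inner_of_lt y₀ (by omega) hlt c' hc]
    exact sum_congr rfl fun _ _ => by ring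

lemma shell_inner_self (h : TwoShellDesign n e l m A k w) (y₀ : ι) {r : ℕ}
    (hr : r < e) (c : Finset (Fin n) → ℝ) {c' : Finset (Fin n) → ℝ} (hc' : IsHarmonic r c') :
    ∑ y with k y = k y₀, w y * (upFun r c (A y) * upFun r c' (A y)) =
      theta n k w (k y₀) r * ∑ T ∈ powersetCard r univ, c T * c' T := by
  have h1 := h.le_k y₀
  have h2 := h.two_mul_lt
  rw [sum_upFun_mul_upFun _ A w (fun t => totalWeight k w (k y₀) *
      ((n - t).choose (k y₀) : ℝ) / (n.choose (k y₀) : ℝ))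
    (fun T hT => h.sum_shell y₀ T (by omega)) c hc',
    fwdDiff_iter_shell_moment _ (by omega) (by omega), theta]
  congr 1
  refine sum_congr rfl fun T hT => ?_
  rw [upFun_of_card_eq _ (mem_powersetCard.1 hT).2]

lemma inner_top (h : TwoShellDesign n e l m A k w)
    (c : Finset (Fin n) → ℝ) {c' : Finset (Fin n) → ℝ} (hc' : IsHarmonic e c') :
    ∑ y, w y * (upFun e c (A y) * upFun e c' (A y)) =
      (theta n k w l e + theta n k w m e) * ∑ T ∈ powersetCard e univ, c T * c' T := by
  have h1 := h.le_l
  have h2 := h.two_mul_lt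
  have h3 := h.l_lt_m
  rw [sum_upFun_mul_upFun _ A w (fun t => totalWeight k w l *
      ((n - t).choose l : ℝ) / (n.choose l : ℝ) + totalWeight k w m *
      ((n - t).choose m : ℝ) / (n.choose m : ℝ))
    (fun T hT => h.sum_all T (by omega)) c hc']
  have e1 : (fwdDiff 1)^[e] (fun j => totalWeight k w l * ((n - (e + e - j)).choose l : ℝ) /
      (n.choose l : ℝ) + totalWeight k w m * ((n - (e + e - j)).choose m : ℝ) /
      (n.choose m : ℝ)) 0 = theta n k w l e + theta n k w m e := by
    rw [theta, theta, ← fwdDiff_iter_shell_moment (totalWeight k w l) h1 (by omega),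
      ← fwdDiff_iter_shell_moment (totalWeight k w m) (by omega : e ≤ m) (by omega), ← Pi.add_apply,
      ← fwdDiff_iter_add]
    rfl
  rw [e1]
  congr 1
  refine sum_congr rfl fun T hT => ?_
  rw [upFun_of_card_eq _ (mem_powersetCard.1 hT).2]

lemma isHarmonic (h : TwoShellDesign n e l m A k w) {r : ℕ} (hr : r ≤ e) (y : ι) :
    IsHarmonic r (zonal n r (k y) (A y)) :=
  isHarmonic_zonal (hr.trans (h.le_k y)) (h.card_add y)

/-- The zonal kernel is a Gram matrix. -/
lemma zonalKernel_eq_sum (h : TwoShellDesign n e l m A k w) {r : ℕ} (hr : r ≤ e) (y z : ι) :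
    ∑ T ∈ powersetCard r univ, zonal n r (k y) (A y) T * zonal n r (k z) (A z) T =
      zonalKernel A k r y z :=
  (h.isHarmonic hr y).sum_mul_zonal (by have := h.two_mul_lt; omega) (hr.trans (h.le_k z)) _

lemma zonalKernel_comm (h : TwoShellDesign n e l m A k w) {r : ℕ} (hr : r ≤ e) (y z : ι) :
    zonalKernel A k r y z = zonalKernel A k r z y := by
  rw [← h.zonalKernel_eq_sum hr, ← h.zonalKernel_eq_sum hr]
  exact sum_congr rfl fun _ _ => mul_comm _ _

lemma zonalKernel_mul_of_ne (h : TwoShellDesign n e l m A k w) {r s : ℕ} (hr : r ≤ e) (hs : s ≤ e)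
    (hne : r ≠ s) (y₀ y u : ι) :
    ∑ z with k z = k y₀, w z * (zonalKernel A k r y z * zonalKernel A k s z u) = 0 := by
  rw [← h.shell_inner_of_ne y₀ (by omega) hne (h.isHarmonic hr y) (h.isHarmonic hs u)]
  exact sum_congr rfl fun z _ => by rw [h.zonalKernel_comm hs z u]; rfl

lemma zonalKernel_mul_self (h : TwoShellDesign n e l m A k w) {r : ℕ} (hr : r < e) (y₀ y u : ι) :
    ∑ z with k z = k y₀, w z * (zonalKernel A k r y z * zonalKernel A k r z u) =
      theta n k w (k y₀) r * zonalKernel A k r y u := by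
  rw [← h.zonalKernel_eq_sum hr.le, ← h.shell_inner_self y₀ hr _ (h.isHarmonic hr.le u)]
  exact sum_congr rfl fun z _ => by rw [h.zonalKernel_comm hr.le z u]; rfl

lemma zonalKernel_mul_top (h : TwoShellDesign n e l m A k w) (y u : ι) :
    ∑ z, w z * (zonalKernel A k e y z * zonalKernel A k e z u) =
      (theta n k w l e + theta n k w m e) * zonalKernel A k e y u := by
  rw [← h.zonalKernel_eq_sum le_rfl, ← h.inner_top _ (h.isHarmonic le_rfl u)]
  exact sum_congr rfl fun z _ => by rw [h.zonalKernel_comm le_rfl z u]; rfl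

lemma zonalKernel_eq (h : TwoShellDesign n e l m A k w) {r : ℕ} (hr : r ≤ e) (y z : ι) :
    zonalKernel A k r y z = ((n - k z).choose r : ℝ) / zonalCoeff n r (k y) r *
        (hahnPoly n r (k y) (k z)).eval ((A z \ A y).card : ℝ) :=
  upFun_zonal (h.card_add z) (by have := h.k_add_le z; omega)

/-- Within a shell the zonal kernel is a positive multiple of the Hahn polynomial of `|A z \ A
y|`. -/
lemma zonalKernel_same (h : TwoShellDesign n e l m A k w) {r : ℕ} (hr : r ≤ e) {y z : ι}
    (hyz : k y = k z) :
    zonalKernel A k r y z = theta n k w (k y) r / totalWeight k w (k y) * binomDiff n r *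
        (hahnPoly n r (k y) (k y)).eval ((A z \ A y).card : ℝ) := by
  have h1 := h.le_k y
  have h2 := h.k_add_le y
  rw [h.zonalKernel_eq hr, ← hyz]
  congr 1
  have h3 := choose_div_zonalCoeff (n := n) (a := k y) (r := r) (by omega) (by omega)
  have h4 : (n.choose (k y) : ℝ) ≠ 0 := by exact_mod_cast (Nat.choose_pos (by omega)).ne'
  have h5 := (h.totalWeight_pos y).ne'
  apply mul_right_cancel₀ h4
  rw [h3, theta]
  field_simp

end TwoShellDesign

/-! ### The reproducing kernel of a tight design -/

/-- The part of the reproducing kernel of degree less than `e`: on each shell, the reproducing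
kernel of the functions of degree less than `e` on that shell. -/
noncomputable def shellKernel (n e : ℕ) {ι : Type*} [Fintype ι] (A : ι → Finset (Fin n))
    (k : ι → ℕ) (w : ι → ℝ) (y z : ι) : ℝ :=
  if k y = k z then ∑ r ∈ range e, zonalKernel A k r y z / theta n k w (k y) r else 0

/-- The reproducing kernel of the functions of degree at most `e` on the two shells. In degree `e`
the functions on the two shells are coupled, so that only one copy of the harmonics occurs, with
the sum of the two norms. -/
noncomputable def reproducingKernel (n e l m : ℕ) {ι : Type*} [Fintype ι] (A : ι → Finset (Fin n))
    (k : ι → ℕ) (w : ι → ℝ) (y z : ι) : ℝ :=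
  shellKernel n e A k w y z + zonalKernel A k e y z / (theta n k w l e + theta n k w m e)

namespace TwoShellDesign

variable {n e l m : ℕ} {ι : Type*} [Fintype ι] {A : ι → Finset (Fin n)} {k : ι → ℕ} {w : ι → ℝ}

lemma shellKernel_comm (h : TwoShellDesign n e l m A k w) (y z : ι) :
    shellKernel n e A k w y z = shellKernel n e A k w z y := by
  rw [shellKernel, shellKernel]
  by_cases hyz : k y = k z
  · rw [if_pos hyz, if_pos hyz.symm, hyz]
    refine sum_congr rfl fun r hr => ?_
    rw [h.zonalKernel_comm (by have := mem_range.1 hr; omega)]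
  · rw [if_neg hyz, if_neg (Ne.symm hyz)]

lemma sum_shell_eq (f : ι → ℝ) (y : ι) (hf : ∀ z, k y ≠ k z → f z = 0) :
    ∑ z, f z = ∑ z with k z = k y, f z := by
  rw [sum_filter]
  refine sum_congr rfl fun z _ => ?_
  split_ifs with hz
  · rfl
  · exact hf z (Ne.symm hz)

lemma shellKernel_mul_self (h : TwoShellDesign n e l m A k w) (y : ι) :
    ∑ z, w z * (shellKernel n e A k w y z * shellKernel n e A k w z y) =
      shellKernel n e A k w y y := by
  rw [sum_shell_eq _ y (fun z hz => by rw [shellKernel, if_neg hz]; ring)]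
  have h1 : ∀ z ∈ ({z | k z = k y} : Finset ι),
      w z * (shellKernel n e A k w y z * shellKernel n e A k w z y) =
      ∑ r ∈ range e, ∑ s ∈ range e, (theta n k w (k y) r)⁻¹ * (theta n k w (k y) s)⁻¹ *
        (w z * (zonalKernel A k r y z * zonalKernel A k s z y)) := by
    intro z hz
    have hz' : k z = k y := by simpa using hz
    rw [shellKernel, shellKernel, if_pos hz'.symm, if_pos hz', hz', sum_mul_sum, mul_sum]
    refine sum_congr rfl fun r _ => ?_
    rw [mul_sum]
    exact sum_congr rfl fun s _ => by ring
  rw [sum_congr rfl h1, sum_comm, shellKernel, if_pos rfl]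
  refine sum_congr rfl fun r hr => ?_
  have hr' := mem_range.1 hr
  rw [sum_comm, sum_eq_single_of_mem r hr]
  · rw [← mul_sum, h.zonalKernel_mul_self hr']
    have := (h.theta_pos y hr'.le).ne'
    field_simp
  · intro s hs hne
    have hs' := mem_range.1 hs
    rw [← mul_sum, h.zonalKernel_mul_of_ne hr'.le hs'.le (Ne.symm hne), mul_zero]

lemma shellKernel_mul_zonalKernel (h : TwoShellDesign n e l m A k w) (y : ι) :
    ∑ z, w z * (shellKernel n e A k w y z * zonalKernel A k e z y) = 0 := by
  rw [sum_shell_eq _ y (fun z hz => by rw [shellKernel, if_neg hz]; ring)]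
  have h1 : ∀ z ∈ ({z | k z = k y} : Finset ι),
      w z * (shellKernel n e A k w y z * zonalKernel A k e z y) =
      ∑ r ∈ range e, (theta n k w (k y) r)⁻¹ *
        (w z * (zonalKernel A k r y z * zonalKernel A k e z y)) := by
    intro z hz
    have hz' : k z = k y := by simpa using hz
    rw [shellKernel, if_pos hz'.symm, sum_mul, mul_sum]
    exact sum_congr rfl fun r _ => by ring
  rw [sum_congr rfl h1, sum_comm]
  refine sum_eq_zero fun r hr => ?_
  have hr' := mem_range.1 hr
  rw [← mul_sum, h.zonalKernel_mul_of_ne hr'.le le_rfl hr'.ne, mul_zero]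

lemma theta_add_pos (h : TwoShellDesign n e l m A k w) :
    0 < theta n k w l e + theta n k w m e := by
  obtain ⟨y, hy⟩ := h.nonempty_l
  obtain ⟨z, hz⟩ := h.nonempty_m
  rw [← hy, ← hz]
  exact add_pos (h.theta_pos y le_rfl) (h.theta_pos z le_rfl)

lemma sum_reproducingKernel_sq (h : TwoShellDesign n e l m A k w) (y : ι) :
    ∑ z, w z * reproducingKernel n e l m A k w y z ^ 2 =
      reproducingKernel n e l m A k w y y := by
  have h0 := h.theta_add_pos.ne'
  have h1 : ∀ z, w z * reproducingKernel n e l m A k w y z ^ 2 =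
      w z * (shellKernel n e A k w y z * shellKernel n e A k w z y) +
      2 / (theta n k w l e + theta n k w m e) *
        (w z * (shellKernel n e A k w y z * zonalKernel A k e z y)) +
      1 / (theta n k w l e + theta n k w m e) ^ 2 *
        (w z * (zonalKernel A k e y z * zonalKernel A k e z y)) := by
    intro z
    rw [reproducingKernel, h.shellKernel_comm z y, h.zonalKernel_comm le_rfl z y]
    field_simp
    ring
  rw [sum_congr rfl fun z _ => h1 z, sum_add_distrib, sum_add_distrib, ← mul_sum, ← mul_sum,
    h.shellKernel_mul_self, h.shellKernel_mul_zonalKernel, h.zonalKernel_mul_top,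
    reproducingKernel]
  field_simp
  ring

/-- The scalar `κ_e` is, up to a power of two, the norm of the harmonics of degree `e`. -/
lemma two_pow_mul_kappa (n e l m : ℕ) {ι : Type*} [Fintype ι] (k : ι → ℕ) (w : ι → ℝ) :
    2 ^ (n - 2 * e) * kappa n e l m (totalWeight k w l) (totalWeight k w m) =
      theta n k w l e + theta n k w m e := by
  rw [kappa, theta, theta, mul_add]
  congr 1 <;>
  · rw [← div_div, mul_div_assoc', mul_div_cancel₀]
    positivity

lemma reproducingKernel_same (h : TwoShellDesign n e l m A k w) {y z : ι} (hyz : k y = k z) :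
    reproducingKernel n e l m A k w y z =
      (psiDiag n e (k y) (totalWeight k w (k y))
        (kappa n e l m (totalWeight k w l) (totalWeight k w m))).eval ((A z \ A y).card : ℝ) /
        totalWeight k w (k y) := by
  have hW := (h.totalWeight_pos y).ne'
  have hΘ := h.theta_add_pos.ne'
  rw [reproducingKernel, shellKernel, if_pos hyz, psiDiag, Polynomial.eval_add,
    Polynomial.eval_finsetSum, add_div, sum_div]
  congr 1
  · refine sum_congr rfl fun r hr => ?_
    have hr' := mem_range.1 hr
    have hθ := (h.theta_pos y hr'.le).ne'
    rw [h.zonalKernel_same hr'.le hyz, Polynomial.eval_mul, Polynomial.eval_C]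
    field_simp
  · rw [h.zonalKernel_same le_rfl hyz, Polynomial.eval_mul, Polynomial.eval_C, two_pow_mul_kappa]
    generalize theta n k w l e + theta n k w m e = Θ
    rw [theta]
    field_simp

lemma psiDiag_eval_zero (n e a : ℕ) (W κ : ℝ) : (psiDiag n e a W κ).eval 0 =
    ∑ r ∈ range e, binomDiff n r +
      W * ((n - 2 * e).choose (a - e) : ℝ) * binomDiff n e /
        (2 ^ (n - 2 * e) * κ * (n.choose a : ℝ)) := by
  simp [psiDiag, Polynomial.eval_finsetSum, hahnPoly_eval_zero]

/-- The trace of the reproducing kernel is the dimension of the space of functions of degree at most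
`e` on the two shells. -/
lemma trace_reproducingKernel (h : TwoShellDesign n e l m A k w) :
    ∑ y, w y * reproducingKernel n e l m A k w y y =
      2 * ∑ r ∈ range e, binomDiff n r + binomDiff n e := by
  have key : ∀ y₀ : ι, ∑ y with k y = k y₀, w y * reproducingKernel n e l m A k w y y =
      ∑ r ∈ range e, binomDiff n r + theta n k w (k y₀) e /
        (theta n k w l e + theta n k w m e) * binomDiff n e := by
    intro y₀
    have hW := (h.totalWeight_pos y₀).ne'
    have h1 : ∀ y ∈ ({y | k y = k y₀} : Finset ι), w y * reproducingKernel n e l m A k w y y =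
        w y * ((psiDiag n e (k y₀) (totalWeight k w (k y₀))
        (kappa n e l m (totalWeight k w l) (totalWeight k w m))).eval 0 /
        totalWeight k w (k y₀)) := by
      intro y hy
      have hy' : k y = k y₀ := by simpa using hy
      rw [h.reproducingKernel_same rfl, hy', sdiff_self, bot_eq_empty, card_empty,
        Nat.cast_zero]
    rw [sum_congr rfl h1, ← sum_mul, ← totalWeight, mul_div_cancel₀ _ hW, psiDiag_eval_zero,
      two_pow_mul_kappa]
    generalize theta n k w l e + theta n k w m e = Θ
    rw [theta]
    field_simp
  obtain ⟨y, hy⟩ := h.nonempty_l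
  obtain ⟨z, hz⟩ := h.nonempty_m
  have e1 := key y
  have e2 := key z
  have hΘ := h.theta_add_pos.ne'
  rw [hy] at e1
  rw [hz] at e2
  rw [h.sum_shells, e1, e2]
  field_simp
  ring

/-- If there are at most as many points as the trace of the idempotent reproducing kernel, then this
kernel is the identity: the weighted sum of the squares of the entries of the difference is the
number of points minus the trace. -/
lemma reproducingKernel_eq (h : TwoShellDesign n e l m A k w) [DecidableEq ι]
    (hcard : (Fintype.card ι : ℝ) ≤ 2 * ∑ r ∈ range e, binomDiff n r + binomDiff n e) (y z : ι) :
    reproducingKernel n e l m A k w y z = if y = z then (w y)⁻¹ else 0 := by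
  set K := reproducingKernel n e l m A k w with hK
  have hsum : ∑ y, ∑ z, w y * (w z * (K y z - if y = z then (w y)⁻¹ else 0) ^ 2) =
      Fintype.card ι - ∑ y, w y * K y y := by
    have h1 : ∀ y, ∑ z, w y * (w z * (K y z - if y = z then (w y)⁻¹ else 0) ^ 2) =
        1 - w y * K y y := by
      intro y
      have hy := (h.pos y).ne'
      rw [← mul_sum]
      have h2 : ∀ z, w z * (K y z - if y = z then (w y)⁻¹ else 0) ^ 2 =
          w z * K y z ^ 2 + if y = z then (w y)⁻¹ - 2 * K y y else 0 := by
        intro z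
        split_ifs with hyz
        · subst hyz; field_simp; ring
        · ring
      rw [sum_congr rfl fun z _ => h2 z, sum_add_distrib, h.sum_reproducingKernel_sq,
        sum_ite_eq univ y, if_pos (mem_univ y)]
      field_simp; ring
    rw [sum_congr rfl fun y _ => h1 y, sum_sub_distrib, sum_const, nsmul_eq_mul, mul_one,
      card_univ]
  rw [hK, h.trace_reproducingKernel] at hsum
  have hnn : ∀ y z, 0 ≤ w y * (w z * (K y z - if y = z then (w y)⁻¹ else 0) ^ 2) := fun y z =>
    mul_nonneg (h.pos y).le (mul_nonneg (h.pos z).le (sq_nonneg _))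
  have h0 : ∑ y, ∑ z, w y * (w z * (K y z - if y = z then (w y)⁻¹ else 0) ^ 2) = 0 :=
    le_antisymm (by rw [hsum]; linarith) (sum_nonneg fun y _ => sum_nonneg fun z _ => hnn y z)
  have h1 := (sum_eq_zero_iff_of_nonneg fun y _ => sum_nonneg fun z _ => hnn y z).1 h0 y
    (mem_univ y)
  have h2 := (sum_eq_zero_iff_of_nonneg fun z _ => hnn y z).1 h1 z (mem_univ z)
  have h3 := (h.pos y).ne'
  have h4 := (h.pos z).ne'
  have h5 : (K y z - if y = z then (w y)⁻¹ else 0) ^ 2 = 0 := by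
    simpa [h3, h4] using h2
  exact sub_eq_zero.1 (pow_eq_zero_iff two_ne_zero |>.1 h5)

end TwoShellDesign

/-- A two-shell design is tight if its points are distinct and there are at most as many of them as
the dimension of the space of functions of degree at most `e`. -/
structure TightTwoShellDesign (n e l m : ℕ) {ι : Type*} [Fintype ι] (A : ι → Finset (Fin n))
    (k : ι → ℕ) (w : ι → ℝ) : Prop extends TwoShellDesign n e l m A k w where
  injective : Function.Injective A
  card_le : (Fintype.card ι : ℝ) ≤ 2 * ∑ r ∈ range e, binomDiff n r + binomDiff n e

namespace TightTwoShellDesign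

variable {n e l m : ℕ} {ι : Type*} [Fintype ι] {A : ι → Finset (Fin n)} {k : ι → ℕ} {w : ι → ℝ}

/-- Off the diagonal of a shell the reproducing kernel, that is `ψ_e^{a,a}`, vanishes. -/
lemma psiDiag_eval_eq_zero (h : TightTwoShellDesign n e l m A k w) {y z : ι} (hk : k y = k z)
    (hyz : y ≠ z) :
    (psiDiag n e (k y) (totalWeight k w (k y))
        (kappa n e l m (totalWeight k w l) (totalWeight k w m))).eval
          ((A z \ A y).card : ℝ) = 0 := by
  classical
  have h1 := h.reproducingKernel_same hk
  rw [h.reproducingKernel_eq h.card_le, if_neg hyz] at h1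
  have hW := (h.totalWeight_pos y).ne'
  exact (div_eq_zero_iff.1 h1.symm).resolve_right hW

/-- The diagonal entry `(w y)⁻¹` of the reproducing kernel depends only on the shell of `y`. -/
lemma weight_eq (h : TightTwoShellDesign n e l m A k w) {y z : ι} (hk : k y = k z) :
    w y = w z := by
  classical
  have h1 := h.reproducingKernel_same (y := y) rfl
  have h2 := h.reproducingKernel_same (y := z) rfl
  rw [h.reproducingKernel_eq h.card_le, if_pos rfl, sdiff_self] at h1 h2
  rw [← hk, ← h1] at h2
  exact inv_injective h2.symm

/-- Between different shells the reproducing kernel reduces to the zonal kernel of degree `e`. -/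
lemma hahnPoly_eval_eq_zero (h : TightTwoShellDesign n e l m A k w) {y z : ι} (hne : k y ≠ k z) :
    (hahnPoly n e (k y) (k z)).eval ((A z \ A y).card : ℝ) = 0 := by
  classical
  have h1 := h.reproducingKernel_eq h.card_le y z
  rw [if_neg (fun e => hne (by rw [e])), reproducingKernel, shellKernel, if_neg hne, zero_add,
    div_eq_zero_iff, or_iff_left h.theta_add_pos.ne', h.zonalKernel_eq le_rfl] at h1
  have h2 := h.le_k y
  have h3 := h.k_add_le z
  have h4 := h.two_mul_lt
  refine (mul_eq_zero.1 h1).resolve_left (div_ne_zero ?_ ?_)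
  · exact_mod_cast (Nat.choose_pos (by omega)).ne'
  · exact (zonalCoeff_self_pos (by omega) (by omega)).ne'

end TightTwoShellDesign

/-! ### Zeros of the polynomials -/

lemma natDegree_ascPochhammer_comp_neg (k : ℕ) :
    ((ascPochhammer ℝ k).comp (-Polynomial.X)).natDegree = k := by
  rw [Polynomial.natDegree_comp, Polynomial.natDegree_neg, Polynomial.natDegree_X,
    ascPochhammer_natDegree, mul_one]

lemma ascPochhammer_eval_neg_natCast_ne_zero {x k : ℕ} (h : k ≤ x) :
    (ascPochhammer ℝ k).eval (-(x : ℝ)) ≠ 0 := by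
  rw [ascPochhammer_eval_neg_natCast]
  have h1 : (k.factorial : ℝ) ≠ 0 := by exact_mod_cast k.factorial_ne_zero
  have h2 : (x.choose k : ℝ) ≠ 0 := by exact_mod_cast (Nat.choose_pos h).ne'
  have h3 : ((-1 : ℝ)) ^ k ≠ 0 := by simp
  positivity

lemma degree_hahnPoly {n r i j : ℕ} (hi : r ≤ i) (hj : j + r ≤ n) (hr : 2 * r ≤ n) :
    (hahnPoly n r i j).degree = r := by
  have e1 : (j : ℝ) - n = -((n - j : ℕ) : ℝ) := by rw [Nat.cast_sub (by omega)]; ring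
  have e2 : (r : ℝ) - n - 1 = -((n + 1 - r : ℕ) : ℝ) := by
    rw [Nat.cast_sub (by omega)]; push_cast; ring
  have h1 : (r.factorial : ℝ) ≠ 0 := by exact_mod_cast r.factorial_ne_zero
  have h2 : ((ascPochhammer ℝ r).comp (-Polynomial.X)).degree = r := by
    rw [Polynomial.degree_eq_natDegree, natDegree_ascPochhammer_comp_neg]
    intro h
    have h3 := congrArg (Polynomial.eval (-1)) h
    rw [Polynomial.eval_comp] at h3
    simp only [Polynomial.eval_neg, Polynomial.eval_X, neg_neg, Polynomial.eval_zero,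
      ascPochhammer_eval_one] at h3
    exact h1 h3
  rw [hahnPoly, sum_range_succ, Polynomial.degree_add_eq_right_of_degree_lt] <;>
    rw [Polynomial.degree_C_mul (a := _ / _) (by
      rw [e1, e2]
      exact div_ne_zero (mul_ne_zero (ascPochhammer_eval_neg_natCast_ne_zero le_rfl)
        (ascPochhammer_eval_neg_natCast_ne_zero (by omega)))
        (mul_ne_zero (mul_ne_zero (ascPochhammer_eval_neg_natCast_ne_zero (by omega))
          (ascPochhammer_eval_neg_natCast_ne_zero hi)) h1)), h2]
  rw [← Polynomial.mem_degreeLT]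
  refine Submodule.sum_mem _ fun k hk => ?_
  rw [← Polynomial.smul_eq_C_mul]
  refine Submodule.smul_mem _ _ ?_
  rw [Polynomial.mem_degreeLT]
  refine Polynomial.degree_le_natDegree.trans_lt ?_
  rw [natDegree_ascPochhammer_comp_neg]
  exact_mod_cast mem_range.1 hk

lemma exists_eq_sum_of_degree_lt (e : ℕ) (f : ℕ → ℝ[X]) (hf : ∀ r < e, (f r).degree = r)
    (p : ℝ[X]) (hp : p.degree < e) : ∃ c : ℕ → ℝ, p = ∑ r ∈ range e, Polynomial.C (c r) * f r := by
  induction e generalizing p with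
  | zero =>
    refine ⟨0, ?_⟩
    rw [range_zero, sum_empty]
    simpa using hp
  | succ e ih =>
    have hfe := hf e (by omega)
    have hfc : (f e).coeff e ≠ 0 := Polynomial.coeff_ne_zero_of_eq_degree hfe
    have hp' : (p - Polynomial.C (p.coeff e / (f e).coeff e) * f e).degree < e := by
      rw [← Polynomial.mem_degreeLT, Polynomial.mem_degreeLT, Polynomial.degree_lt_iff_coeff_zero]
      intro t ht
      rcases ht.eq_or_lt with hte | ht
      · rw [← hte, Polynomial.coeff_sub, Polynomial.coeff_C_mul, div_mul_cancel₀ _ hfc, sub_self]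
      · rw [Polynomial.coeff_sub, Polynomial.coeff_C_mul,
          Polynomial.coeff_eq_zero_of_degree_lt (n := t) (hfe.trans_lt (by exact_mod_cast ht)),
          Polynomial.coeff_eq_zero_of_degree_lt (n := t) (hp.trans_le (by exact_mod_cast ht))]
        simp
    obtain ⟨c, hc⟩ := ih (fun r hr => hf r (by omega)) _ hp'
    refine ⟨Function.update c e (p.coeff e / (f e).coeff e), ?_⟩
    rw [sum_range_succ, Function.update_self, ← sub_eq_iff_eq_add, hc]
    refine sum_congr rfl fun r hr => ?_
    rw [Function.update_of_ne (mem_range.1 hr).ne]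

lemma degree_psiDiag {n e a : ℕ} {W κ : ℝ} (ha : e ≤ a) (han : a + e ≤ n) (hn : 2 * e ≤ n)
    (hW : 0 < W) (hκ : 0 < κ) : (psiDiag n e a W κ).degree = e := by
  have hC : 0 < W * ((n - 2 * e).choose (a - e) : ℝ) * binomDiff n e /
      (2 ^ (n - 2 * e) * κ * (n.choose a : ℝ)) := by
    have h1 := binomDiff_pos hn
    have h2 : 0 < (n - 2 * e).choose (a - e) := Nat.choose_pos (by omega)
    have h3 : 0 < n.choose a := Nat.choose_pos (by omega)
    positivity
  have h1 : (Polynomial.C (W * ((n - 2 * e).choose (a - e) : ℝ) * binomDiff n e /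
      (2 ^ (n - 2 * e) * κ * (n.choose a : ℝ))) * hahnPoly n e a a).degree = e := by
    rw [Polynomial.degree_C_mul hC.ne', degree_hahnPoly ha han hn]
  rw [psiDiag, Polynomial.degree_add_eq_right_of_degree_lt, h1]
  rw [h1, ← Polynomial.mem_degreeLT]
  refine Submodule.sum_mem _ fun r hr => ?_
  have hr' := mem_range.1 hr
  rw [← Polynomial.smul_eq_C_mul]
  refine Submodule.smul_mem _ _ ?_
  rw [Polynomial.mem_degreeLT, degree_hahnPoly (by omega) (by omega) (by omega)]
  exact_mod_cast hr'

/-- A polynomial of degree `e` that vanishes on a set on which no nonzero polynomial of smaller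
degree vanishes has precisely this set as its set of zeros, and the set has `e` elements. -/
lemma card_eq_and_zeroSet_eq {P : ℝ[X]} {e : ℕ} (hP : P.degree = e) (S : Finset ℕ)
    (hS : ∀ s ∈ S, P.eval (s : ℝ) = 0)
    (hmin : ∀ p : ℝ[X], p.degree < e → (∀ s ∈ S, p.eval (s : ℝ) = 0) → p = 0) :
    S.card = e ∧ zeroSet P = {ξ : ℂ | ∃ s ∈ S, ξ = (s : ℂ)} := by
  set Q : ℝ[X] := ∏ s ∈ S, (Polynomial.X - Polynomial.C (s : ℝ)) with hQ
  have hQm : Q.Monic := Polynomial.monic_prod_of_monic _ _ fun s _ => Polynomial.monic_X_sub_C _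
  have hQd : Q.degree = S.card := by
    rw [hQ, Polynomial.degree_prod, sum_congr rfl fun s _ => Polynomial.degree_X_sub_C _]
    simp
  have hQ0 : ∀ s ∈ S, Q.eval (s : ℝ) = 0 := fun s hs => by
    rw [hQ, Polynomial.eval_prod]
    exact prod_eq_zero hs (by simp)
  have hP0 : P ≠ 0 := by
    rintro rfl
    simp at hP
  have hcard : S.card = e := by
    apply le_antisymm
    · have h1 : (S.image (fun s : ℕ => (s : ℝ))).val ⊆ P.roots := by
        intro s hs
        rw [mem_val, mem_image] at hs
        obtain ⟨t, ht, rfl⟩ := hs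
        rw [Polynomial.mem_roots hP0]
        exact hS t ht
      have h2 := Polynomial.card_le_degree_of_subset_roots h1
      rwa [card_image_of_injective _ Nat.cast_injective,
        Polynomial.natDegree_eq_of_degree_eq_some hP] at h2
    · by_contra! hlt
      exact hQm.ne_zero (hmin Q (by rw [hQd]; exact_mod_cast hlt) hQ0)
  refine ⟨hcard, ?_⟩
  have hlc : P.leadingCoeff ≠ 0 := by simpa using hP0
  have hPQ : P = Polynomial.C P.leadingCoeff * Q := by
    rw [← sub_eq_zero]
    apply hmin
    · rw [← hP]
      apply Polynomial.degree_sub_lt_left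
      · rw [Polynomial.degree_C_mul hlc, hQd, hP, hcard]
      · exact hP0
      · rw [Polynomial.leadingCoeff_mul, hQm.leadingCoeff, Polynomial.leadingCoeff_C, mul_one]
    · intro s hs
      rw [Polynomial.eval_sub, Polynomial.eval_mul, hS s hs, hQ0 s hs]; simp
  ext ξ
  simp only [zeroSet, Set.mem_ofPred_eq]
  rw [hPQ, map_mul, Polynomial.aeval_C, hQ, map_prod]
  simp [hlc, prod_eq_zero_iff, sub_eq_zero]

namespace TwoShellDesign

variable {n e l m : ℕ} {ι : Type*} [Fintype ι] {A : ι → Finset (Fin n)} {k : ι → ℕ} {w : ι → ℝ}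

/-- On a pair of shells a polynomial of degree less than `e` in `|A z \ A y|` is a combination of
zonal kernels, with coefficients that determine the polynomial. -/
lemma exists_eval_eq_sum (h : TwoShellDesign n e l m A k w) (y₀ z₀ : ι) (p : ℝ[X])
    (hp : p.degree < e) : ∃ c : ℕ → ℝ, (c = 0 → p = 0) ∧ (∀ r, e ≤ r → c r = 0) ∧
      ∀ y z, k y = k y₀ → k z = k z₀ →
      p.eval ((A z \ A y).card : ℝ) = ∑ r ∈ range e, c r * zonalKernel A k r y z := by
  have h1 := h.le_k y₀
  have h2 := h.k_add_le z₀
  have h3 := h.two_mul_lt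
  obtain ⟨c, hc⟩ := exists_eq_sum_of_degree_lt e (fun r => Polynomial.C
    (((n - k z₀).choose r : ℝ) / zonalCoeff n r (k y₀) r) * hahnPoly n r (k y₀) (k z₀))
    (fun r hr => by
      rw [Polynomial.degree_C_mul, degree_hahnPoly (by omega) (by omega) (by omega)]
      refine div_ne_zero ?_ ?_
      · exact_mod_cast (Nat.choose_pos (by omega)).ne'
      · exact (zonalCoeff_self_pos (by omega) (by omega)).ne') p hp
  have hc' : ∀ r ∈ range e, (if r < e then c r else 0) = c r := fun r hr =>
    if_pos (mem_range.1 hr)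
  refine ⟨fun r => if r < e then c r else 0, fun h0 => ?_, fun r hr => if_neg (by omega),
    fun y z hy hz => ?_⟩
  · rw [hc]
    refine sum_eq_zero fun r hr => ?_
    rw [← hc' r hr, show (if r < e then c r else 0) = 0 from congrFun h0 r]
    simp
  · rw [hc, Polynomial.eval_finsetSum]
    refine sum_congr rfl fun r hr => ?_
    have hr' := mem_range.1 hr
    simp only [hc' r hr]
    rw [h.zonalKernel_eq hr'.le, hy, hz]
    simp

lemma zonalKernel_self_pos (h : TwoShellDesign n e l m A k w) {r : ℕ} (hr : r ≤ e) (y : ι) :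
    0 < zonalKernel A k r y y := by
  rw [h.zonalKernel_same hr rfl, sdiff_self]
  have h1 := h.theta_pos y hr
  have h2 := h.totalWeight_pos y
  have h3 := binomDiff_pos (show 2 * r ≤ n by have := h.two_mul_lt; omega)
  simp only [bot_eq_empty, card_empty, Nat.cast_zero, hahnPoly_eval_zero]
  positivity

/-- A polynomial of degree less than `e` that vanishes at `|A z \ A y|` for a fixed point `y` and
all other points `z` of a shell is zero. If `y` lies in this shell too, then orthogonality to the
zonal kernel of degree `e` shows first that the polynomial also vanishes at `0`. -/
lemma eq_zero_of_eval_eq_zero (h : TwoShellDesign n e l m A k w) (y z₀ : ι) (p : ℝ[X])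
    (hp : p.degree < e)
    (hz : ∀ z, k z = k z₀ → z ≠ y → p.eval ((A z \ A y).card : ℝ) = 0) : p = 0 := by
  classical
  obtain ⟨c, hc0, hce, hc⟩ := h.exists_eval_eq_sum y z₀ p hp
  have hsum : ∀ s ≤ e, ∑ z with k z = k z₀,
      w z * (p.eval ((A z \ A y).card : ℝ) * zonalKernel A k s z y) =
      if s < e then c s * (theta n k w (k z₀) s * zonalKernel A k s y y) else 0 := by
    intro s hs
    have h1 : ∀ z ∈ ({z | k z = k z₀} : Finset ι),
        w z * (p.eval ((A z \ A y).card : ℝ) * zonalKernel A k s z y) =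
        ∑ r ∈ range e, c r * (w z * (zonalKernel A k r y z * zonalKernel A k s z y)) := by
      intro z hz
      rw [hc y z rfl (by simpa using hz), sum_mul, mul_sum]
      exact sum_congr rfl fun r _ => by ring
    rw [sum_congr rfl h1, sum_comm]
    simp_rw [← mul_sum]
    split_ifs with hse
    · rw [sum_eq_single_of_mem s (mem_range.2 hse), h.zonalKernel_mul_self hse]
      intro r hr hne
      rw [h.zonalKernel_mul_of_ne (mem_range.1 hr).le hs hne, mul_zero]
    · refine sum_eq_zero fun r hr => ?_
      have hr' := mem_range.1 hr
      rw [h.zonalKernel_mul_of_ne hr'.le hs (by omega), mul_zero]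
  have hval : ∀ z, k z = k z₀ → p.eval ((A z \ A y).card : ℝ) = 0 := by
    intro z hzk
    by_cases hzy : z = y
    · subst hzy
      have h1 := hsum e le_rfl
      rw [if_neg (lt_irrefl e), sum_eq_single_of_mem z (by simpa using hzk)] at h1
      · have h2 := (h.zonalKernel_self_pos le_rfl z).ne'
        have h3 := (h.pos z).ne'
        simpa [h2, h3] using h1
      · intro u hu hne
        rw [hz u (by simpa using hu) hne]; ring
    · exact hz z hzk hzy
  -- the zonal components of `p` are recovered by pairing with the zonal kernels
  refine hc0 (funext fun s => ?_)
  by_cases hs : s < e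
  · have h1 := hsum s hs.le
    rw [if_pos hs, sum_eq_zero fun z hzk => by rw [hval z (by simpa using hzk)]; ring] at h1
    have h2 := (h.zonalKernel_self_pos hs.le y).ne'
    have h3 := (h.theta_pos z₀ hs.le).ne'
    simpa [h2, h3] using h1.symm
  · exact hce s (by omega)

lemma kappa_pos (h : TwoShellDesign n e l m A k w) :
    0 < kappa n e l m (totalWeight k w l) (totalWeight k w m) := by
  have h1 := two_pow_mul_kappa n e l m k w
  have h2 := h.theta_add_pos
  rw [← h1] at h2
  exact pos_of_mul_pos_right h2 (by positivity)

lemma degree_psiDiag (h : TwoShellDesign n e l m A k w) (y : ι) :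
    (psiDiag n e (k y) (totalWeight k w (k y))
        (kappa n e l m (totalWeight k w l) (totalWeight k w m))).degree = e :=
  HypercubeDesign.degree_psiDiag (h.le_k y) (h.k_add_le y) h.two_mul_lt.le (h.totalWeight_pos y)
    h.kappa_pos

end TwoShellDesign

/-! ### Block functions -/

/-- The values of `|A z \ A y|` for distinct points `y`, `z` of the shells of index `a` and `b`. -/
noncomputable def diffSet {n : ℕ} {ι : Type*} [Fintype ι] (A : ι → Finset (Fin n)) (k : ι → ℕ)
    (a b : ℕ) : Finset ℕ :=
  open Classical in
  ({p : ι × ι | k p.1 = a ∧ k p.2 = b ∧ p.1 ≠ p.2} : Finset (ι × ι)).image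
    fun p => (A p.2 \ A p.1).card

lemma mem_diffSet {n : ℕ} {ι : Type*} [Fintype ι] {A : ι → Finset (Fin n)} {k : ι → ℕ}
    {a b s : ℕ} : s ∈ diffSet A k a b ↔
      ∃ y z, k y = a ∧ k z = b ∧ y ≠ z ∧ (A z \ A y).card = s := by
  simp [diffSet, and_assoc]

/-- A function of pairs of points is a block function if it depends only on the shells of the two
points and on `|A z \ A y|`. -/
def IsBlockFunction {n : ℕ} {ι : Type*} (A : ι → Finset (Fin n)) (k : ι → ℕ)
    (F : ι → ι → ℝ) : Prop :=
  ∀ y z y' z', k y = k y' → k z = k z' → (A z \ A y).card = (A z' \ A y').card → F y z = F y' z'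

lemma TwoShellDesign.isBlockFunction_zonalKernel {n e l m : ℕ} {ι : Type*} [Fintype ι]
    {A : ι → Finset (Fin n)} {k : ι → ℕ} {w : ι → ℝ}
    (h : TwoShellDesign n e l m A k w) {r : ℕ} (hr : r ≤ e) :
    IsBlockFunction A k (zonalKernel A k r) := by
  intro y z y' z' hy hz hd
  rw [h.zonalKernel_eq hr, h.zonalKernel_eq hr, hy, hz, hd]

namespace TightTwoShellDesign

variable {n e l m : ℕ} {ι : Type*} [Fintype ι] {A : ι → Finset (Fin n)} {k : ι → ℕ} {w : ι → ℝ}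

lemma eq_iff (h : TightTwoShellDesign n e l m A k w) {y z : ι} (hk : k y = k z) :
    y = z ↔ (A z \ A y).card = 0 := by
  constructor
  · rintro rfl; simp
  · intro h0
    rw [card_eq_zero, sdiff_eq_empty_iff_subset] at h0
    have h1 := h.card_add y
    have h2 := h.card_add z
    exact h.injective (eq_of_subset_of_card_le h0 (by omega)).symm

lemma card_diffSet_and_zeroSet (h : TightTwoShellDesign n e l m A k w) (y₀ z₀ : ι) {P : ℝ[X]}
    (hP : P.degree = e) (hv : ∀ y z, k y = k y₀ → k z = k z₀ → y ≠ z →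
      P.eval ((A z \ A y).card : ℝ) = 0) :
    (diffSet A k (k y₀) (k z₀)).card = e ∧
      zeroSet P = {ξ : ℂ | ∃ s ∈ diffSet A k (k y₀) (k z₀), ξ = (s : ℂ)} := by
  refine card_eq_and_zeroSet_eq hP _ ?_ ?_
  · intro s hs
    obtain ⟨y, z, hy, hz, hne, rfl⟩ := mem_diffSet.1 hs
    exact hv y z hy hz hne
  · intro p hp hS
    refine h.eq_zero_of_eval_eq_zero y₀ z₀ p hp fun z hz hne => ?_
    exact hS _ (mem_diffSet.2 ⟨y₀, z, rfl, hz, hne.symm, rfl⟩)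

lemma diag_zeros (h : TightTwoShellDesign n e l m A k w) (y₀ : ι) :
    (diffSet A k (k y₀) (k y₀)).card = e ∧
      zeroSet (psiDiag n e (k y₀) (totalWeight k w (k y₀))
        (kappa n e l m (totalWeight k w l) (totalWeight k w m))) =
          {ξ : ℂ | ∃ s ∈ diffSet A k (k y₀) (k y₀), ξ = (s : ℂ)} :=
  h.card_diffSet_and_zeroSet y₀ y₀ (h.degree_psiDiag y₀) fun y z hy hz hne => by
    rw [← hy]
    exact h.psiDiag_eval_eq_zero (hy.trans hz.symm) hne

lemma off_zeros (h : TightTwoShellDesign n e l m A k w) {y₀ z₀ : ι} (hne : k y₀ ≠ k z₀) :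
    (diffSet A k (k y₀) (k z₀)).card = e ∧
      zeroSet (hahnPoly n e (k y₀) (k z₀)) =
          {ξ : ℂ | ∃ s ∈ diffSet A k (k y₀) (k z₀), ξ = (s : ℂ)} :=
  h.card_diffSet_and_zeroSet y₀ z₀
    (degree_hahnPoly (h.le_k y₀) (h.k_add_le z₀) h.two_mul_lt.le) fun y z hy hz _ => by
    rw [← hy, ← hz]
    exact h.hahnPoly_eval_eq_zero (by rwa [hy, hz])

lemma card_diffSet (h : TightTwoShellDesign n e l m A k w) (y₀ z₀ : ι) :
    (diffSet A k (k y₀) (k z₀)).card = e := by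
  by_cases hk : k y₀ = k z₀
  · rw [← hk]; exact (h.diag_zeros y₀).1
  · exact (h.off_zeros hk).1

/-- On each pair of shells the block functions are spanned by the zonal kernels of degree less than
`e` and the identity. -/
lemma exists_eq_sum (h : TightTwoShellDesign n e l m A k w) [DecidableEq ι] {F : ι → ι → ℝ}
    (hF : IsBlockFunction A k F) (y₀ z₀ : ι) :
    ∃ (c : ℕ → ℝ) (d : ℝ), ∀ y z, k y = k y₀ → k z = k z₀ →
      F y z = ∑ r ∈ range e, c r * zonalKernel A k r y z + if y = z then d else 0 := by
  -- `F` depends only on the number of elements of `A z \ A y`; off the diagonal this takes `e`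
  -- values, so that `F` is interpolated there by a polynomial of degree less than `e`
  have : Nonempty ι := ⟨y₀⟩
  choose! f hf using fun s (hs : s ∈ diffSet A k (k y₀) (k z₀)) => mem_diffSet.1 hs
  choose! g hg using hf
  set p := Lagrange.interpolate (diffSet A k (k y₀) (k z₀)) (fun s : ℕ => (s : ℝ))
    (fun s => F (f s) (g s)) with hp
  have hinj : Set.InjOn (fun s : ℕ => (s : ℝ)) (diffSet A k (k y₀) (k z₀)) :=
    Nat.cast_injective.injOn
  have hdeg : p.degree < e := by
    have := Lagrange.degree_interpolate_lt (fun s => F (f s) (g s)) hinj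
    rwa [h.card_diffSet] at this
  obtain ⟨c, -, -, hc⟩ := h.exists_eval_eq_sum y₀ z₀ p hdeg
  refine ⟨c, F y₀ y₀ - p.eval 0, fun y z hy hz => ?_⟩
  rw [← hc y z hy hz]
  split_ifs with hyz
  · subst hyz
    rw [hF y y y₀ y₀ hy hy (by simp)]
    simp
  · have hmem : (A z \ A y).card ∈ diffSet A k (k y₀) (k z₀) :=
      mem_diffSet.2 ⟨y, z, hy, hz, hyz, rfl⟩
    have h1 := Lagrange.eval_interpolate_at_node (fun s => F (f s) (g s)) hinj hmem
    obtain ⟨h2, h3, -, h4⟩ := hg _ hmem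
    rw [add_zero, hp, h1]
    exact hF _ _ _ _ (hy.trans h2.symm) (hz.trans h3.symm) h4.symm

/-- The matrix product of block functions through one shell is a block function, since the zonal
kernels and the identity multiply among themselves. -/
lemma isBlockFunction_sum_shell (h : TightTwoShellDesign n e l m A k w) {F G : ι → ι → ℝ}
    (hF : IsBlockFunction A k F) (hG : IsBlockFunction A k G) (z₀ : ι) :
    IsBlockFunction A k fun y u => ∑ z with k z = k z₀, F y z * G z u := by
  classical
  intro y₁ u₁ y₂ u₂ hy hu hd
  obtain ⟨c, d, hc⟩ := h.exists_eq_sum hF y₁ z₀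
  obtain ⟨c', d', hc'⟩ := h.exists_eq_sum hG z₀ u₁
  have hw := (h.pos z₀).ne'
  have key : ∀ y u, k y = k y₁ → k u = k u₁ → ∑ z with k z = k z₀, F y z * G z u =
      (w z₀)⁻¹ * ∑ r ∈ range e, c r * c' r *
        (theta n k w (k z₀) r * zonalKernel A k r y u) +
      (if k u = k z₀ then d' * ∑ r ∈ range e, c r * zonalKernel A k r y u else 0) +
      (if k y = k z₀ then d * G y u else 0) := by
    intro y u hy hu
    have e1 : ∀ z ∈ ({z | k z = k z₀} : Finset ι), F y z * G z u =
        (w z₀)⁻¹ * ∑ r ∈ range e, ∑ s ∈ range e,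
          c r * c' s * (w z * (zonalKernel A k r y z * zonalKernel A k s z u)) +
        (if z = u then d' * ∑ r ∈ range e, c r * zonalKernel A k r y u else 0) +
        (if y = z then d * G y u else 0) := by
      intro z hz
      have hz' : k z = k z₀ := by simpa using hz
      have e2 : (w z₀)⁻¹ * ∑ r ∈ range e, ∑ s ∈ range e,
          c r * c' s * (w z * (zonalKernel A k r y z * zonalKernel A k s z u)) =
          (∑ r ∈ range e, c r * zonalKernel A k r y z) *
            ∑ s ∈ range e, c' s * zonalKernel A k s z u := by
        rw [sum_mul_sum, mul_sum]
        refine sum_congr rfl fun r _ => ?_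
        rw [mul_sum]
        refine sum_congr rfl fun s _ => ?_
        rw [h.weight_eq hz']
        field_simp
      have e3 : (if y = z then d * G y u else 0) = (if y = z then d else 0) * G z u := by
        split_ifs with hyz
        · rw [hyz]
        · simp
      have e4 : (if z = u then d' * ∑ r ∈ range e, c r * zonalKernel A k r y u else 0) =
          (∑ r ∈ range e, c r * zonalKernel A k r y z) * (if z = u then d' else 0) := by
        split_ifs with hzu
        · rw [hzu, mul_comm]
        · simp
      rw [e2, e3, e4, hc y z hy hz', add_mul, hc' z u hz' hu, mul_add]
    rw [sum_congr rfl e1, sum_add_distrib, sum_add_distrib, ← mul_sum]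
    congr 1
    · congr 1
      · congr 1
        rw [sum_comm]
        refine sum_congr rfl fun r hr => ?_
        have hr' := mem_range.1 hr
        rw [sum_comm, sum_eq_single_of_mem r hr]
        · rw [← mul_sum, h.zonalKernel_mul_self hr']
        · intro s hs hne
          rw [← mul_sum, h.zonalKernel_mul_of_ne hr'.le (mem_range.1 hs).le (Ne.symm hne), mul_zero]
      · rw [sum_ite_eq']
        simp
    · rw [sum_ite_eq]
      simp
  change ∑ z with k z = k z₀, F y₁ z * G z u₁ = ∑ z with k z = k z₀, F y₂ z * G z u₂
  rw [key y₁ u₁ rfl rfl, key y₂ u₂ hy.symm hu.symm, hG y₁ u₁ y₂ u₂ hy hu hd, hy, hu]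
  have hΦ : ∀ r ∈ range e, zonalKernel A k r y₁ u₁ = zonalKernel A k r y₂ u₂ := fun r hr =>
    h.isBlockFunction_zonalKernel (mem_range.1 hr).le _ _ _ _ hy hu hd
  have hΦ' : ∀ a : ℕ → ℝ, ∑ r ∈ range e, a r * zonalKernel A k r y₁ u₁ =
      ∑ r ∈ range e, a r * zonalKernel A k r y₂ u₂ := fun a =>
    sum_congr rfl fun r hr => by rw [hΦ r hr]
  simp_rw [← mul_assoc]
  rw [hΦ', hΦ']

lemma isBlockFunction_sum (h : TightTwoShellDesign n e l m A k w) {F G : ι → ι → ℝ}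
    (hF : IsBlockFunction A k F) (hG : IsBlockFunction A k G) :
    IsBlockFunction A k fun y u => ∑ z, F y z * G z u := by
  obtain ⟨y₀, hy₀⟩ := h.nonempty_l
  obtain ⟨z₀, hz₀⟩ := h.nonempty_m
  intro y u y' u' hy hu hd
  have h1 := h.isBlockFunction_sum_shell hF hG y₀ y u y' u' hy hu hd
  have h2 := h.isBlockFunction_sum_shell hF hG z₀ y u y' u' hy hu hd
  rw [hy₀] at h1
  rw [hz₀] at h2
  change ∑ z, F y z * G z u = ∑ z, F y' z * G z u'
  rw [h.sum_shells, h.sum_shells fun z => F y' z * G z u']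
  exact congrArg₂ (· + ·) h1 h2

end TightTwoShellDesign

/-! ### The adjacency algebra of a coherent configuration -/

section CoherentAlgebra

variable {X : Type*} [Fintype X] {R : Set (Set (X × X))}

/-- The adjacency span consists of the matrices that are constant on each relation. -/
lemma mem_adjacencySpan_iff (hR : Setoid.IsPartition R) (M : Matrix X X ℂ) :
    M ∈ adjacencySpan R ↔ ∀ r ∈ R, ∀ p ∈ r, ∀ q ∈ r, M p.1 p.2 = M q.1 q.2 := by
  classical
  constructor
  · intro hM
    induction hM using Submodule.span_induction with
    | mem M hM =>
      obtain ⟨s, hs, rfl⟩ := hM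
      intro r hr p hp q hq
      have hiff : p ∈ s ↔ q ∈ s := by
        constructor
        · intro h; rwa [← hR.pairwiseDisjoint.elim hr hs (Set.not_disjoint_iff.2 ⟨p, hp, h⟩)]
        · intro h; rwa [← hR.pairwiseDisjoint.elim hr hs (Set.not_disjoint_iff.2 ⟨q, hq, h⟩)]
      simp [relationMatrix, hiff]
    | zero => simp
    | add M N _ _ hM hN =>
      intro r hr p hp q hq
      rw [Matrix.add_apply, Matrix.add_apply, hM r hr p hp q hq, hN r hr p hp q hq]
    | smul c M _ hM =>
      intro r hr p hp q hq
      rw [Matrix.smul_apply, Matrix.smul_apply, hM r hr p hp q hq]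
  · intro h
    have hne : ∀ r ∈ R, r.Nonempty := fun r hr => Setoid.nonempty_of_mem_partition hR hr
    rcases isEmpty_or_nonempty (X × X) with hX | hX
    · rw [show M = 0 from Matrix.ext fun y z => (hX.false (y, z)).elim]
      exact Submodule.zero_mem _
    choose! f hf using hne
    have hM : M = ∑ r ∈ R.toFinite.toFinset, M (f r).1 (f r).2 • relationMatrix r := by
      ext y z
      obtain ⟨r, ⟨hr, hyz⟩, -⟩ := hR.2 (y, z)
      rw [Matrix.sum_apply, Finset.sum_eq_single_of_mem r (by simpa using hr)]
      · simp [relationMatrix, hyz, h r hr (y, z) hyz (f r) (hf r hr)]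
      · intro s hs hne
        have hs' : s ∈ R := by simpa using hs
        have : (y, z) ∉ s := fun hys =>
          hne (hR.pairwiseDisjoint.elim hs' hr (Set.not_disjoint_iff.2 ⟨(y, z), hys, hyz⟩))
        simp [relationMatrix, this]
    rw [hM]
    refine Submodule.sum_mem _ fun r hr => Submodule.smul_mem _ _ (Submodule.subset_span ?_)
    exact ⟨r, by simpa using hr, rfl⟩

lemma relationMatrix_mul_apply (r s : Set (X × X)) (x y : X) :
    (relationMatrix r * relationMatrix s) x y =
      (({z : X | (x, z) ∈ r ∧ (z, y) ∈ s}.ncard : ℕ) : ℂ) := by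
  classical
  rw [Matrix.mul_apply, Set.ncard_eq_toFinset_card', Finset.card_eq_sum_ones, Nat.cast_sum,
    Set.toFinset_ofPred, Finset.sum_filter]
  refine Finset.sum_congr rfl fun z _ => ?_
  by_cases h1 : (x, z) ∈ r <;> by_cases h2 : (z, y) ∈ s <;> simp [relationMatrix, h1, h2]

lemma _root_.IsCoherentConfiguration.isCoherentAlgebra [DecidableEq X]
    (hR : IsCoherentConfiguration R) : IsCoherentAlgebra (adjacencySpan R) := by
  have hmem := mem_adjacencySpan_iff hR.isPartition
  have hone : (1 : Matrix X X ℂ) ∈ adjacencySpan R := by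
    rw [hmem]
    obtain ⟨R₀, hR₀, hdiag⟩ := hR.diagonal
    have hiff : ∀ r ∈ R, ∀ p ∈ r, p.1 = p.2 → ∀ q ∈ r, q.1 = q.2 := by
      intro r hr p hp hpd q hq
      have hp' : p ∈ ⋃₀ R₀ := by rw [hdiag]; exact hpd
      obtain ⟨s, hs, hps⟩ := hp'
      have hrs := hR.isPartition.pairwiseDisjoint.elim hr (hR₀ hs)
        (Set.not_disjoint_iff.2 ⟨p, hp, hps⟩)
      have hq' : q ∈ ⋃₀ R₀ := ⟨s, hs, hrs ▸ hq⟩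
      rw [hdiag] at hq'
      exact hq'
    intro r hr p hp q hq
    rw [Matrix.one_apply, Matrix.one_apply]
    by_cases h : p.1 = p.2
    · rw [if_pos h, if_pos (hiff r hr p hp h q hq)]
    · rw [if_neg h, if_neg fun h' => h (hiff r hr q hq h' p hp)]
  have hmul : ∀ M ∈ adjacencySpan R, ∀ N ∈ adjacencySpan R, M * N ∈ adjacencySpan R := by
    intro M hM N hN
    have h1 : adjacencySpan R * adjacencySpan R ≤ adjacencySpan R := by
      conv_lhs => rw [adjacencySpan, Submodule.span_mul_span]
      rw [Submodule.span_le]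
      rintro _ ⟨_, ⟨r, hr, rfl⟩, _, ⟨s, hs, rfl⟩, rfl⟩
      simp only [SetLike.mem_coe]
      rw [hmem]
      intro t ht p hp q hq
      obtain ⟨c, hc⟩ := hR.intersection r hr s hs t ht
      rw [relationMatrix_mul_apply, relationMatrix_mul_apply, hc _ _ hp, hc _ _ hq]
    exact h1 (Submodule.mul_mem_mul hM hN)
  refine ⟨⟨(adjacencySpan R).toSubalgebra hone fun M N hM hN => hmul M hM N hN, ?_⟩, ?_, ?_, ?_⟩
  · ext M; simp
  · rw [hmem]; simp
  · intro M hM N hN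
    rw [hmem] at hM hN ⊢
    intro r hr p hp q hq
    rw [Matrix.hadamard_apply, Matrix.hadamard_apply, hM r hr p hp q hq, hN r hr p hp q hq]
  · intro M hM
    rw [hmem] at hM ⊢
    intro r hr p hp q hq
    rw [Matrix.conjTranspose_apply, Matrix.conjTranspose_apply]
    exact congrArg star (hM _ (hR.transpose r hr) (p.2, p.1) hp (q.2, q.1) hq)

end CoherentAlgebra

/-! ### Vertices of the hypercube as sets of coordinates -/

section Cube

variable {n : ℕ}

/-- The set of coordinates in which `y` agrees with `x`. Its complement is the support of `y`
relative to the base vertex `x`. -/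
def agreement (x y : Cube n) : Finset (Fin n) := {i | x i = y i}

lemma mem_agreement {x y : Cube n} {i : Fin n} : i ∈ agreement x y ↔ x i = y i := by
  simp [agreement]

lemma card_agreement_add (x y : Cube n) : (agreement x y).card + hammingDist x y = n := by
  have := card_filter_add_card_filter_not (s := (univ : Finset (Fin n))) (fun i => x i = y i)
  rwa [card_univ, Fintype.card_fin] at this

lemma agreement_injective (x : Cube n) : Function.Injective (agreement x) := by
  intro y z h
  funext i
  have hi : x i = y i ↔ x i = z i := by rw [← mem_agreement, ← mem_agreement, h]
  revert hi
  cases x i <;> cases y i <;> cases z i <;> simp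

lemma hammingDist_eq (x y z : Cube n) :
    hammingDist y z = (agreement x z \ agreement x y).card +
      (agreement x y \ agreement x z).card := by
  rw [← card_union_of_disjoint disjoint_sdiff_sdiff, hammingDist]
  congr 1
  ext i
  simp only [mem_filter, mem_univ, true_and, mem_union, mem_sdiff, mem_agreement]
  cases x i <;> cases y i <;> cases z i <;> simp

/-- The distance of two vertices in terms of `|A z \ A y|` and the indices of their shells. -/
lemma hammingDist_add (x y z : Cube n) :
    hammingDist y z + hammingDist x y =
      2 * (agreement x z \ agreement x y).card + hammingDist x z := by
  have h1 := hammingDist_eq x y z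
  have h2 := card_agreement_add x y
  have h3 := card_agreement_add x z
  have h4 := card_sdiff_add_card_inter (agreement x y) (agreement x z)
  have h5 := card_sdiff_add_card_inter (agreement x z) (agreement x y)
  rw [inter_comm] at h5
  omega

end Cube

/-! ### The coherent configuration of a tight relative design -/

section Configuration

variable {n e l m : ℕ} {x : Cube n} {Y : Finset (Cube n)} {w : Y → ℝ}

/-- The shells of the two vertices of a pair, and their distance. -/
def pairType (x : Cube n) (Y : Finset (Cube n)) (p : Y × Y) : ℕ × ℕ × ℕ :=
  (hammingDist x p.1.1, hammingDist x p.2.1, hammingDist p.1.1 p.2.1)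

/-- The relations on `Y`: the non-empty classes of pairs with equal shells and distance. -/
def pairRelations (x : Cube n) (Y : Finset (Cube n)) : Set (Set (Y × Y)) :=
  (Setoid.ker (pairType x Y)).classes

/-- The weighted subset `(Y, w)` of the cube is a tight two-shell design. -/
abbrev IsTight (n e l m : ℕ) (x : Cube n) (Y : Finset (Cube n)) (w : Y → ℝ) : Prop :=
  TightTwoShellDesign n e l m (fun y : Y => agreement x y.1) (fun y : Y => hammingDist x y.1) w

lemma isBlockFunction_comp_pairType (f : ℕ × ℕ × ℕ → ℝ) :
    IsBlockFunction (fun y : Y => agreement x y.1) (fun y : Y => hammingDist x y.1)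
      fun y z => f (pairType x Y (y, z)) := by
  intro y z y' z' hy hz hd
  have h1 := hammingDist_add x y.1 z.1
  have h2 := hammingDist_add x y'.1 z'.1
  have h3 : pairType x Y (y, z) = pairType x Y (y', z') := by
    simp only [pairType, Prod.mk.injEq]
    refine ⟨hy, hz, ?_⟩
    dsimp only at hy hz hd
    omega
  simp only [h3]

/-- The intersection numbers are well defined because they are matrix products of block
functions. -/
lemma isCoherentConfiguration (h : IsTight n e l m x Y w) :
    IsCoherentConfiguration (pairRelations x Y) where
  isPartition := Setoid.isPartition_classes _
  diagonal := by
    refine ⟨{r ∈ pairRelations x Y | r ⊆ Set.diagonal Y}, fun r hr => hr.1, ?_⟩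
    ext p
    constructor
    · rintro ⟨r, hr, hp⟩; exact hr.2 hp
    · intro hp
      refine ⟨{q | pairType x Y q = pairType x Y p}, ⟨⟨p, rfl⟩, fun q hq => ?_⟩, rfl⟩
      have hp' : p.1 = p.2 := hp
      have hq' : pairType x Y q = pairType x Y p := hq
      simp only [pairType, Prod.mk.injEq, hp', hammingDist_self, hammingDist_eq_zero] at hq'
      exact Subtype.ext hq'.2.2
  transpose := by
    rintro r ⟨q, rfl⟩
    refine ⟨q.swap, ?_⟩
    ext p
    change pairType x Y p.swap = pairType x Y q ↔ pairType x Y p = pairType x Y q.swap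
    simp only [pairType, Prod.mk.injEq, Prod.fst_swap, Prod.snd_swap, hammingDist_comm p.2.1 p.1.1,
      hammingDist_comm q.2.1 q.1.1]
    tauto
  intersection := by
    classical
    rintro r ⟨q, rfl⟩ s ⟨q', rfl⟩ t ⟨q'', rfl⟩
    refine ⟨{z : Y | (q''.1, z) ∈ {p | pairType x Y p = pairType x Y q} ∧
      (z, q''.2) ∈ {p | pairType x Y p = pairType x Y q'}}.ncard, fun y z hyz => ?_⟩
    have hcount : ∀ y z : Y, (({u : Y | (y, u) ∈ {p | pairType x Y p = pairType x Y q} ∧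
        (u, z) ∈ {p | pairType x Y p = pairType x Y q'}}.ncard : ℕ) : ℝ) =
        ∑ u, (fun T => if T = pairType x Y q then (1:ℝ) else 0) (pairType x Y (y, u)) *
          (fun T => if T = pairType x Y q' then (1:ℝ) else 0) (pairType x Y (u, z)) := by
      intro y z
      rw [Set.ncard_eq_toFinset_card', card_eq_sum_ones, Nat.cast_sum, Set.toFinset_ofPred,
        sum_filter]
      refine sum_congr rfl fun u _ => ?_
      by_cases h1 : pairType x Y (y, u) = pairType x Y q <;>
      by_cases h2 : pairType x Y (u, z) = pairType x Y q' <;> simp [h1, h2]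
    have hyz' : pairType x Y (y, z) = pairType x Y q'' := hyz
    simp only [pairType, Prod.mk.injEq] at hyz'
    have hblock := h.isBlockFunction_sum
      (isBlockFunction_comp_pairType fun T => if T = pairType x Y q then (1:ℝ) else 0)
      (isBlockFunction_comp_pairType fun T => if T = pairType x Y q' then (1:ℝ) else 0)
      y z q''.1 q''.2 hyz'.1 hyz'.2.1 (by
        have h1 := hammingDist_add x y.1 z.1
        have h2 := hammingDist_add x q''.1.1 q''.2.1
        dsimp only
        omega)
    have := (hcount y z).trans (hblock.trans (hcount q''.1 q''.2).symm)
    exact_mod_cast this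

lemma mem_distSet {a b j : ℕ} : j ∈ distSet x Y a b ↔
    ∃ y z : Y, hammingDist x y.1 = a ∧ hammingDist x z.1 = b ∧ hammingDist y.1 z.1 = j := by
  constructor
  · rintro ⟨y, hy, z, hz, h⟩; exact ⟨y, z, hy, hz, h⟩
  · rintro ⟨y, z, hy, hz, h⟩; exact ⟨y, hy, z, hz, h⟩

lemma distSet_comm (a b : ℕ) : distSet x Y a b = distSet x Y b a := by
  ext j
  rw [mem_distSet, mem_distSet]
  constructor <;>
  · rintro ⟨y, z, hy, hz, hj⟩
    exact ⟨z, y, hz, hy, by rw [hammingDist_comm]; exact hj⟩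

/-- The set `diffSet` of a subset of the cube; its elements are the values of `ξ`. -/
noncomputable abbrev cubeDiffSet (x : Cube n) (Y : Finset (Cube n)) (a b : ℕ) : Finset ℕ :=
  diffSet (fun y : Y => agreement x y.1) (fun y : Y => hammingDist x y.1) a b

lemma mem_distSet_of_ne {a b : ℕ} (hab : a ≠ b) {j : ℕ} :
    j ∈ distSet x Y a b ↔ ∃ s ∈ cubeDiffSet x Y a b, j + a = 2 * s + b := by
  rw [mem_distSet]
  constructor
  · rintro ⟨y, z, hy, hz, rfl⟩
    refine ⟨_, mem_diffSet.2 ⟨y, z, hy, hz, fun h => hab ?_, rfl⟩, ?_⟩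
    · rw [← hy, ← hz, h]
    · rw [← hy, ← hz]; exact hammingDist_add x y.1 z.1
  · rintro ⟨s, hs, hj⟩
    obtain ⟨y, z, hy, hz, -, rfl⟩ := mem_diffSet.1 hs
    refine ⟨y, z, hy, hz, ?_⟩
    have := hammingDist_add x y.1 z.1
    omega

lemma mem_distSet_self {a : ℕ} (ha : ∃ y : Y, hammingDist x y.1 = a) {j : ℕ} :
    j ∈ distSet x Y a a ↔ j = 0 ∨ ∃ s ∈ cubeDiffSet x Y a a, j = 2 * s := by
  rw [mem_distSet]
  constructor
  · rintro ⟨y, z, hy, hz, rfl⟩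
    by_cases hyz : y = z
    · left; rw [hyz, hammingDist_self]
    · right
      refine ⟨_, mem_diffSet.2 ⟨y, z, hy, hz, hyz, rfl⟩, ?_⟩
      have := hammingDist_add x y.1 z.1
      omega
  · rintro (rfl | ⟨s, hs, rfl⟩)
    · obtain ⟨y, hy⟩ := ha
      exact ⟨y, y, hy, hy, hammingDist_self _⟩
    · obtain ⟨y, z, hy, hz, -, rfl⟩ := mem_diffSet.1 hs
      refine ⟨y, z, hy, hz, ?_⟩
      have := hammingDist_add x y.1 z.1
      omega

lemma zero_notMem_cubeDiffSet_self (h : IsTight n e l m x Y w) (a : ℕ) :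
    0 ∉ cubeDiffSet x Y a a := by
  intro h0
  obtain ⟨y, z, hy, hz, hne, hs⟩ := mem_diffSet.1 h0
  exact hne ((h.eq_iff (hy.trans hz.symm)).2 hs)

lemma ncard_distSet_self (h : IsTight n e l m x Y w) (y : Y) :
    (distSet x Y (hammingDist x y.1) (hammingDist x y.1)).ncard = e + 1 := by
  classical
  have h1 : distSet x Y (hammingDist x y.1) (hammingDist x y.1) =
      ↑(insert 0 ((cubeDiffSet x Y (hammingDist x y.1) (hammingDist x y.1)).image (2 * ·))) := by
    ext j
    rw [mem_distSet_self ⟨y, rfl⟩]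
    simp [eq_comm]
  rw [h1, Set.ncard_coe_finset, card_insert_of_notMem, card_image_of_injective]
  · rw [h.card_diffSet y y]
  · intro a b; simp
  · simpa using zero_notMem_cubeDiffSet_self h _

lemma ncard_distSet_of_lt (h : IsTight n e l m x Y w) {y z : Y}
    (hyz : hammingDist x y.1 < hammingDist x z.1) :
    (distSet x Y (hammingDist x y.1) (hammingDist x z.1)).ncard = e := by
  classical
  have h1 : distSet x Y (hammingDist x y.1) (hammingDist x z.1) =
      ↑((cubeDiffSet x Y (hammingDist x y.1) (hammingDist x z.1)).image
        fun s => 2 * s + hammingDist x z.1 - hammingDist x y.1) := by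
    ext j
    rw [mem_distSet_of_ne hyz.ne]
    simp only [coe_image, Set.mem_image, mem_coe]
    refine exists_congr fun s => and_congr_right fun _ => ?_
    omega
  rw [h1, Set.ncard_coe_finset, card_image_of_injective]
  · exact h.card_diffSet y z
  · intro a b hab
    dsimp only at hab
    omega

lemma fibers_pairRelations :
    fibers (pairRelations x Y) = {Φ | ∃ y : Y, Φ = shellPart x Y (hammingDist x y.1)} := by
  have hclass : ∀ y : Y, {p : Y × Y | pairType x Y p = pairType x Y (y, y)} =
      (fun z => (z, z)) '' shellPart x Y (hammingDist x y.1) := by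
    intro y
    ext ⟨u, v⟩
    simp only [pairType, hammingDist_self, Prod.mk.injEq, hammingDist_eq_zero, Set.mem_ofPred_eq,
      Set.mem_image, shellPart]
    constructor
    · rintro ⟨h1, -, h2⟩
      exact ⟨u, h1, rfl, Subtype.ext h2⟩
    · rintro ⟨z, hz, rfl, rfl⟩
      exact ⟨hz, hz, rfl⟩
  have hinj : Function.Injective fun z : Y => (z, z) := fun a b hab => (Prod.mk.inj hab).1
  ext Φ
  constructor
  · rintro ⟨⟨y, z⟩, hq⟩
    have hq' : (fun z => (z, z)) '' Φ = {p | pairType x Y p = pairType x Y (y, z)} := hq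
    have hmem : (y, z) ∈ (fun z => (z, z)) '' Φ := by rw [hq']; rfl
    obtain ⟨u, hu, huv⟩ := hmem
    obtain ⟨rfl, rfl⟩ := Prod.mk.inj huv
    rw [hclass] at hq'
    exact ⟨_, hinj.image_injective hq'⟩
  · rintro ⟨y, rfl⟩
    exact ⟨(y, y), (hclass y).symm⟩

lemma ncard_relations_subset (a b : ℕ) :
    {r ∈ pairRelations x Y | r ⊆ shellPart x Y a ×ˢ shellPart x Y b}.ncard =
      (distSet x Y a b).ncard := by
  have h1 : {r ∈ pairRelations x Y | r ⊆ shellPart x Y a ×ˢ shellPart x Y b} =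
      (fun j => {p | pairType x Y p = (a, b, j)}) '' distSet x Y a b := by
    ext r
    constructor
    · rintro ⟨⟨q, rfl⟩, hr⟩
      have hq : q ∈ shellPart x Y a ×ˢ shellPart x Y b := hr rfl
      obtain ⟨hq1, hq2⟩ := hq
      have hq1' : hammingDist x q.1.1 = a := hq1
      have hq2' : hammingDist x q.2.1 = b := hq2
      refine ⟨hammingDist q.1.1 q.2.1, mem_distSet.2 ⟨q.1, q.2, hq1', hq2', rfl⟩, ?_⟩
      ext p
      change _ = _ ↔ pairType x Y p = pairType x Y q
      rw [pairType, pairType, hq1', hq2']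
    · rintro ⟨j, hj, rfl⟩
      obtain ⟨y, z, hy, hz, rfl⟩ := mem_distSet.1 hj
      refine ⟨⟨(y, z), ?_⟩, ?_⟩
      · rw [← hy, ← hz]; rfl
      · intro p hp
        have hp' : pairType x Y p = (a, b, hammingDist y.1 z.1) := hp
        simp only [pairType, Prod.mk.injEq] at hp'
        exact ⟨hp'.1, hp'.2.1⟩
  rw [h1, Set.InjOn.ncard_image]
  intro i hi j hj hij
  obtain ⟨y, z, hy, hz, rfl⟩ := mem_distSet.1 hi
  have hmem : (y, z) ∈ {p | pairType x Y p = (a, b, hammingDist y.1 z.1)} := by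
    rw [← hy, ← hz]; rfl
  dsimp only at hij
  rw [hij] at hmem
  have hmem' : pairType x Y (y, z) = (a, b, j) := hmem
  simp only [pairType, Prod.mk.injEq] at hmem'
  exact hmem'.2.2

lemma hasType (h : IsTight n e l m x Y w) :
    HasType (pairRelations x Y) ![shellPart x Y l, shellPart x Y m] !![e + 1, e; e, e + 1] := by
  obtain ⟨y, hy⟩ := h.nonempty_l
  obtain ⟨z, hz⟩ := h.nonempty_m
  have hlm := h.l_lt_m
  have hne : shellPart x Y l ≠ shellPart x Y m := by
    intro heq
    have hmem : y ∈ shellPart x Y m := by rw [← heq]; exact hy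
    have hmem' : hammingDist x y.1 = m := hmem
    omega
  have hlt : hammingDist x y.1 < hammingDist x z.1 := by
    omega
  have c1 := ncard_distSet_self h y
  have c2 := ncard_distSet_self h z
  have c3 := ncard_distSet_of_lt h hlt
  rw [hy] at c1 c3
  rw [hz] at c2 c3
  refine ⟨?_, ?_, ?_⟩
  · intro i j hij
    fin_cases i <;> fin_cases j <;> simp_all
  · rw [fibers_pairRelations, Matrix.range_cons, Matrix.range_cons, Matrix.range_empty]
    ext Φ
    simp only [Set.union_empty, Set.mem_union, Set.mem_singleton_iff, Set.mem_ofPred_eq]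
    constructor
    · rintro (rfl | rfl)
      · exact ⟨y, by rw [hy]⟩
      · exact ⟨z, by rw [hz]⟩
    · rintro ⟨u, rfl⟩
      rcases h.shell u with hu | hu
      · left; rw [hu]
      · right; rw [hu]
  · intro i j
    fin_cases i <;> fin_cases j
    · exact (ncard_relations_subset l l).trans c1
    · exact (ncard_relations_subset l m).trans c3
    · exact (ncard_relations_subset m l).trans (distSet_comm m l ▸ c3)
    · exact (ncard_relations_subset m m).trans c2

end Configuration

/-! ### Characters of the hypercube and the design condition -/

section Characters

variable {n : ℕ}

/-- The character of the cube that belongs to the set `S`, normalized to be `1` at `x`. -/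
def character (x : Cube n) (S : Finset (Fin n)) (y : Cube n) : ℝ :=
  ∏ i ∈ S, if x i = y i then 1 else -1

lemma character_update (x : Cube n) (S : Finset (Fin n)) (y : Cube n) (i : Fin n) :
    character x S (Function.update y i (!y i)) =
      (if i ∈ S then -1 else 1) * character x S y := by
  have h : ∀ j, (if x j = Function.update y i (!y i) j then (1:ℝ) else -1) =
      (if j = i then -1 else 1) * (if x j = y j then 1 else -1) := by
    intro j
    by_cases hj : j = i
    · subst hj
      rw [Function.update_self, if_pos rfl]
      cases x j <;> cases y j <;> simp
    · rw [Function.update_of_ne hj, if_neg hj, one_mul]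
  simp only [character, h]
  rw [prod_mul_distrib, prod_ite_eq']

/-- The neighbours of `y` are obtained by changing one coordinate. -/
lemma sum_distMatrix_one_mul (y : Cube n) (f : Cube n → ℂ) :
    ∑ z, distMatrix n 1 y z * f z = ∑ i, f (Function.update y i (!y i)) := by
  have h1 : ∀ z, distMatrix n 1 y z * f z = if hammingDist y z = 1 then f z else 0 := by
    intro z; simp [distMatrix]
  rw [sum_congr rfl fun z _ => h1 z, ← sum_filter]
  symm
  refine sum_bij (fun i _ => Function.update y i (!y i)) ?_ ?_ ?_ (fun _ _ => rfl)
  · intro i _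
    rw [mem_filter]
    refine ⟨mem_univ _, ?_⟩
    rw [hammingDist, card_eq_one]
    refine ⟨i, ?_⟩
    ext j
    by_cases hj : j = i
    · subst hj; simp
    · simp [hj]
  · intro i _ j _ hij
    by_contra hne
    have := congrFun hij i
    rw [Function.update_self, Function.update_of_ne hne] at this
    simp at this
  · intro z hz
    have hz' : hammingDist y z = 1 := (mem_filter.1 hz).2
    rw [hammingDist, card_eq_one] at hz'
    obtain ⟨i, hi⟩ := hz'
    refine ⟨i, mem_univ _, ?_⟩
    funext j
    have hj : y j ≠ z j ↔ j = i := by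
      have := congrArg (j ∈ ·) hi
      simpa using this
    by_cases hji : j = i
    · subst hji
      have := hj.2 rfl
      rw [Function.update_self]
      revert this
      cases y j <;> cases z j <;> simp
    · rw [Function.update_of_ne hji]
      by_contra hne
      exact hji (hj.1 hne)

lemma sum_distMatrix_one_mul_character (x : Cube n) (S : Finset (Fin n)) (y : Cube n) :
    ∑ z, distMatrix n 1 y z * (character x S z : ℂ) =
      ((n : ℂ) - 2 * S.card) * (character x S y : ℂ) := by
  rw [sum_distMatrix_one_mul]
  have h1 : ∀ i : Fin n, (character x S (Function.update y i (!y i)) : ℂ) =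
      (1 - 2 * if i ∈ S then 1 else 0) * (character x S y : ℂ) := by
    intro i
    rw [character_update]
    split_ifs <;> push_cast <;> ring
  rw [sum_congr rfl fun i _ => h1 i, ← sum_mul, sum_sub_distrib, ← mul_sum]
  simp

/-- The character as a vector of the standard module. -/
noncomputable def characterVec (x : Cube n) (S : Finset (Fin n)) : StdModule n :=
  WithLp.toLp 2 fun y => (character x S y : ℂ)

lemma characterVec_mem_eigSpace (x : Cube n) (S : Finset (Fin n)) :
    characterVec x S ∈ eigSpace n S.card := by
  rw [eigSpace, Module.End.mem_eigenspace_iff]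
  ext y
  rw [Matrix.toLpLin_apply]
  simp only [PiLp.smul_apply, smul_eq_mul, characterVec, Matrix.mulVec, dotProduct]
  exact sum_distMatrix_one_mul_character x S y

lemma indicator_eq_sum_character (x : Cube n) (T : Finset (Fin n)) (y : Cube n) :
    (if T ⊆ agreement x y then (1:ℝ) else 0) =
      (1 / 2) ^ T.card * ∑ S ∈ T.powerset, character x S y := by
  have h1 : (if T ⊆ agreement x y then (1:ℝ) else 0) =
      ∏ i ∈ T, (1 / 2 * (1 + if x i = y i then 1 else -1)) := by
    split_ifs with h
    · symm
      refine prod_eq_one fun i hi => ?_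
      rw [if_pos (mem_agreement.1 (h hi))]; norm_num
    · obtain ⟨i, hi, hi'⟩ := not_subset.1 h
      symm
      refine prod_eq_zero hi ?_
      rw [if_neg (fun h' => hi' (mem_agreement.2 h'))]; norm_num
  rw [h1, prod_mul_distrib, prod_const, prod_one_add]
  rfl

lemma character_eq_sum_indicator (x : Cube n) (S : Finset (Fin n)) (y : Cube n) :
    character x S y = ∑ T ∈ S.powerset, (2 ^ T.card * (-1) ^ (S \ T).card) *
      (if T ⊆ agreement x y then (1:ℝ) else 0) := by
  have h1 : character x S y = ∏ i ∈ S, ((if x i = y i then (2:ℝ) else 0) + (-1)) := by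
    refine prod_congr rfl fun i _ => ?_
    split_ifs <;> norm_num
  rw [h1, prod_add]
  refine sum_congr rfl fun T _ => ?_
  rw [prod_const]
  split_ifs with h
  · rw [prod_congr rfl fun i hi => if_pos (mem_agreement.1 (h hi)), prod_const, mul_one]
  · obtain ⟨i, hi, hi'⟩ := not_subset.1 h
    rw [prod_eq_zero hi (if_neg (fun h' => hi' (mem_agreement.2 h')))]; simp

lemma character_self (x : Cube n) (S : Finset (Fin n)) : character x S x = 1 := by
  simp [character]

/-- The relative design condition, tested on characters: `⟨χ_S, ω⟩ = ⟨χ_S, E_i ω⟩` with `i = |S|`,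
and `E_i ω = c_i E_i x̂`, where `⟨χ_S, E_i x̂⟩ = χ_S(x) = 1`. -/
lemma exists_sum_mul_character {t : ℕ} {x : Cube n} {Y : Finset (Cube n)} {ω : Cube n → ℝ}
    (hY : IsRelativeDesign t x Y ω) : ∃ c : ℕ → ℝ, ∀ S : Finset (Fin n), S.card ≤ t →
      ∑ y, ω y * character x S y = c S.card := by
  have h1 : ∀ i, ∃ c : ℂ, 1 ≤ i → i ≤ t → c • primIdem n i (EuclideanSpace.single x 1) =
      primIdem n i (WithLp.toLp 2 fun y => (ω y : ℂ)) := by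
    intro i
    by_cases hi : 1 ≤ i ∧ i ≤ t
    · obtain ⟨c, hc⟩ := Submodule.mem_span_singleton.1 (hY.2 i hi.1 hi.2)
      exact ⟨c, fun _ _ => hc⟩
    · exact ⟨0, fun h1 h2 => absurd ⟨h1, h2⟩ hi⟩
  choose c hc using h1
  refine ⟨fun i => if i = 0 then ∑ y, ω y else (c i).re, fun S hS => ?_⟩
  dsimp only
  split_ifs with h0
  · rw [card_eq_zero] at h0
    simp [h0, character]
  · have h2 := hc S.card (by omega) hS
    have hinner : ∀ v : StdModule n,
        inner ℂ (characterVec x S) (primIdem n S.card v) = inner ℂ (characterVec x S) v := by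
      intro v
      rw [primIdem, ← Submodule.inner_starProjection_left_eq_right,
        Submodule.starProjection_eq_self_iff.2 (characterVec_mem_eigSpace x S)]
    have h3 := congrArg (fun v => inner ℂ (characterVec x S) v) h2
    simp only [inner_smul_right, hinner] at h3
    have h4 : inner ℂ (characterVec x S) (WithLp.toLp 2 fun y => (ω y : ℂ)) =
        ((∑ y, ω y * character x S y : ℝ) : ℂ) := by
      simp [PiLp.inner_apply, characterVec]
    have h5 : inner ℂ (characterVec x S) (EuclideanSpace.single x (1:ℂ)) = 1 := by
      rw [EuclideanSpace.inner_single_right]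
      simp [characterVec, character_self]
    rw [h4, h5, mul_one] at h3
    rw [h3, Complex.ofReal_re]

/-- The relative design condition, tested on the indicator functions of subcubes. -/
lemma exists_sum_mul_indicator {t : ℕ} {x : Cube n} {Y : Finset (Cube n)} {ω : Cube n → ℝ}
    (hY : IsRelativeDesign t x Y ω) : ∃ lam : ℕ → ℝ, ∀ T : Finset (Fin n), T.card ≤ t →
      ∑ y, ω y * (if T ⊆ agreement x y then 1 else 0) = lam T.card := by
  obtain ⟨c, hc⟩ := exists_sum_mul_character hY
  refine ⟨fun j => (1 / 2) ^ j * ∑ i ∈ range (j + 1), j.choose i • c i, fun T hT => ?_⟩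
  simp_rw [indicator_eq_sum_character]
  have h1 : ∀ y, ω y * ((1 / 2) ^ T.card * ∑ S ∈ T.powerset, character x S y) =
      ∑ S ∈ T.powerset, (1 / 2) ^ T.card * (ω y * character x S y) := by
    intro y
    rw [mul_sum, mul_sum]
    exact sum_congr rfl fun _ _ => by ring
  rw [sum_congr rfl fun y _ => h1 y, sum_comm]
  simp_rw [← mul_sum]
  rw [← sum_powerset_apply_card c]
  congr 1
  refine sum_congr rfl fun S hS => hc S ?_
  exact (card_le_card (mem_powerset.1 hS)).trans hT

end Characters

/-! ### The dimension bound -/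

section Dimension

variable {n : ℕ}

/-- The indicator function of the subcube of the vertices that agree with `x` on `T`. -/
noncomputable def indicatorVec (x : Cube n) (T : Finset (Fin n)) : StdModule n :=
  WithLp.toLp 2 fun y => ((if T ⊆ agreement x y then (1:ℝ) else 0 : ℝ) : ℂ)

lemma characterVec_mem_span (x : Cube n) {e : ℕ} {S : Finset (Fin n)} (hS : S.card ≤ e) :
    characterVec x S ∈ Submodule.span ℂ (indicatorVec x '' {T | T.card ≤ e}) := by
  have h1 : characterVec x S = ∑ T ∈ S.powerset,
      ((2 ^ T.card * (-1) ^ (S \ T).card : ℝ) : ℂ) • indicatorVec x T := by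
    ext y
    simp only [characterVec, character_eq_sum_indicator, indicatorVec, WithLp.ofLp_sum,
      Finset.sum_apply, PiLp.smul_apply, smul_eq_mul]
    push_cast
    rfl
  rw [h1]
  refine Submodule.sum_mem _ fun T hT => Submodule.smul_mem _ _ (Submodule.subset_span ⟨T, ?_, rfl⟩)
  exact (card_le_card (mem_powerset.1 hT)).trans hS

lemma character_mul_character (x y z : Cube n) (S : Finset (Fin n)) :
    character x S y * character x S z = ∏ i ∈ S, if y i = z i then 1 else -1 := by
  rw [character, character, ← prod_mul_distrib]
  refine prod_congr rfl fun i _ => ?_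
  cases x i <;> cases y i <;> cases z i <;> simp

/-- The characters are complete. -/
lemma sum_character_mul_character (x y z : Cube n) :
    ∑ S : Finset (Fin n), character x S y * character x S z = if y = z then 2 ^ n else 0 := by
  simp_rw [character_mul_character]
  rw [← powerset_univ, ← prod_one_add]
  split_ifs with h
  · subst h
    simp only [if_true]
    norm_num
  · obtain ⟨i, hi⟩ := Function.ne_iff.1 h
    exact prod_eq_zero (mem_univ i) (by rw [if_neg hi]; norm_num)

lemma distMatrix_comm (j : ℕ) (y z : Cube n) : distMatrix n j y z = distMatrix n j z y := by
  simp only [distMatrix, Matrix.of_apply, hammingDist_comm]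

/-- Eigenvectors are orthogonal to the characters of a different degree. -/
lemma sum_character_mul_eq_zero (x : Cube n) {i : ℕ} {v : StdModule n} (hv : v ∈ eigSpace n i)
    {S : Finset (Fin n)} (hS : S.card ≠ i) : ∑ y, (character x S y : ℂ) * v y = 0 := by
  rw [eigSpace, Module.End.mem_eigenspace_iff] at hv
  have h1 : ∀ y, ∑ z, distMatrix n 1 y z * v z = ((n : ℂ) - 2 * i) * v y := fun y => by
    have := congrArg (fun u : StdModule n => u y) hv
    rw [Matrix.toLpLin_apply] at this
    simpa [Matrix.mulVec, dotProduct] using this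
  have h2 : ∑ y, (character x S y : ℂ) * (((n : ℂ) - 2 * i) * v y) =
      ∑ y, (((n : ℂ) - 2 * S.card) * (character x S y : ℂ)) * v y := by
    simp_rw [← h1, ← sum_distMatrix_one_mul_character, mul_sum, sum_mul]
    rw [sum_comm]
    refine sum_congr rfl fun y _ => sum_congr rfl fun z _ => ?_
    rw [distMatrix_comm]; ring
  have h3 : (2 * ((S.card : ℂ) - i)) * ∑ y, (character x S y : ℂ) * v y = 0 := by
    rw [mul_sum, ← sub_eq_zero.2 h2, ← sum_sub_distrib]
    exact sum_congr rfl fun y _ => by ring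
  refine (mul_eq_zero.1 h3).resolve_left (mul_ne_zero two_ne_zero (sub_ne_zero.2 ?_))
  exact_mod_cast hS

lemma eigSpace_le (x : Cube n) (i : ℕ) :
    eigSpace n i ≤ Submodule.span ℂ (characterVec x '' {S | S.card = i}) := by
  intro v hv
  have h1 : v = ∑ S : Finset (Fin n),
      ((2 ^ n : ℂ)⁻¹ * ∑ y, (character x S y : ℂ) * v y) • characterVec x S := by
    ext z
    simp only [characterVec, WithLp.ofLp_sum, Finset.sum_apply, PiLp.smul_apply, smul_eq_mul]
    have h2 : ∀ S : Finset (Fin n), (2 ^ n : ℂ)⁻¹ * (∑ y, (character x S y : ℂ) * v y) *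
        (character x S z : ℂ) = ∑ y, (2 ^ n : ℂ)⁻¹ * (v y *
          ((character x S y * character x S z : ℝ) : ℂ)) := by
      intro S
      rw [mul_assoc, sum_mul, mul_sum]
      refine sum_congr rfl fun y _ => ?_
      push_cast; ring
    rw [sum_congr rfl fun S _ => h2 S, sum_comm]
    simp_rw [← mul_sum, ← Complex.ofReal_sum, sum_character_mul_character]
    rw [sum_eq_single_of_mem z (mem_univ z)]
    · rw [if_pos rfl]; push_cast
      field_simp
    · intro y _ hyz
      rw [if_neg hyz]; simp
  rw [h1]
  refine Submodule.sum_mem _ fun S _ => ?_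
  by_cases hS : S.card = i
  · exact Submodule.smul_mem _ _ (Submodule.subset_span ⟨S, hS, rfl⟩)
  · rw [sum_character_mul_eq_zero x hv hS, mul_zero, zero_smul]
    exact Submodule.zero_mem _

lemma iSup_eigSpace_le (x : Cube n) (e : ℕ) :
    ⨆ i ∈ range (e + 1), eigSpace n i ≤
      Submodule.span ℂ (indicatorVec x '' {T | T.card ≤ e}) := by
  refine iSup₂_le fun i hi => (eigSpace_le x i).trans ?_
  rw [Submodule.span_le]
  rintro _ ⟨S, hS, rfl⟩
  refine characterVec_mem_span x ?_
  rw [show S.card = i from hS]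
  simpa [Nat.lt_succ_iff] using hi

/-- The restriction to the shells `X_l` and `X_m`. -/
noncomputable abbrev shellProj (x : Cube n) (l m : ℕ) : StdModule n →ₗ[ℂ] StdModule n :=
  Matrix.toEuclideanLin (∑ k ∈ ({l, m} : Finset ℕ), dualIdem x k)

lemma shellProj_apply (x : Cube n) {l m : ℕ} (hlm : l ≠ m) (v : StdModule n) (y : Cube n) :
    shellProj x l m v y = if hammingDist x y = l ∨ hammingDist x y = m then v y else 0 := by
  rw [shellProj, Matrix.toLpLin_apply, sum_pair hlm, Matrix.add_mulVec, dualIdem, dualIdem]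
  simp only [Pi.add_apply, Matrix.mulVec_diagonal]
  by_cases h1 : hammingDist x y = l
  · have : ¬ hammingDist x y = m := by omega
    simp [h1, hlm]
  · simp [h1]

lemma sum_indicator_insert (x : Cube n) (S : Finset (Fin n)) (y : Cube n) :
    ∑ j ∈ Sᶜ, (if insert j S ⊆ agreement x y then (1:ℝ) else 0) =
      ((n : ℝ) - hammingDist x y - S.card) * (if S ⊆ agreement x y then 1 else 0) := by
  have h := congrArg (Nat.cast : ℕ → ℝ) (card_agreement_add x y)
  push_cast at h
  rw [sum_insert_subset, ← h]
  ring

/-- On two shells `hammingDist x y` satisfies a quadratic equation, so that the indicator of a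
subcube is a combination of those of its subcubes of codimensions one and two. -/
lemma shellProj_indicatorVec (x : Cube n) {l m : ℕ} (hlm : l ≠ m) (S : Finset (Fin n)) :
    ((((n : ℝ) - l - S.card) * (n - m - S.card) : ℝ) : ℂ) • shellProj x l m (indicatorVec x S) =
      (((n : ℝ) - l + (n - m) - 2 * S.card - 1 : ℝ) : ℂ) •
        ∑ j ∈ Sᶜ, shellProj x l m (indicatorVec x (insert j S)) -
      ∑ j ∈ Sᶜ, ∑ j' ∈ (insert j S)ᶜ,
        shellProj x l m (indicatorVec x (insert j' (insert j S))) := by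
  ext y
  simp only [PiLp.smul_apply, PiLp.sub_apply, WithLp.ofLp_sum, Finset.sum_apply, smul_eq_mul,
    shellProj_apply x hlm, indicatorVec]
  by_cases hy : hammingDist x y = l ∨ hammingDist x y = m
  · simp only [if_pos hy]
    have h1 : ∀ j ∈ Sᶜ, ∑ j' ∈ (insert j S)ᶜ,
        (if insert j' (insert j S) ⊆ agreement x y then (1:ℝ) else 0) =
        ((n : ℝ) - hammingDist x y - S.card - 1) *
          (if insert j S ⊆ agreement x y then 1 else 0) := by
      intro j hj
      rw [sum_indicator_insert, card_insert_of_notMem (by simpa using hj)]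
      push_cast; ring
    simp only [← Complex.ofReal_sum]
    rw [sum_congr rfl h1, ← mul_sum, sum_indicator_insert, ← Complex.ofReal_mul,
      ← Complex.ofReal_mul, ← Complex.ofReal_sub]
    congr 1
    rcases hy with hy | hy <;> rw [hy] <;> ring
  · simp [hy]

/-- On two shells the functions of degree at most `e` are spanned by the indicators of the subcubes
of the codimensions `e` and `e - 1`. -/
lemma shellProj_indicatorVec_mem_span (x : Cube n) {l m e : ℕ} (hlm : l ≠ m) (hl : l + e ≤ n)
    (hm : m + e ≤ n) (S : Finset (Fin n)) (hS : S.card ≤ e) :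
    shellProj x l m (indicatorVec x S) ∈ Submodule.span ℂ
      ((({T | T.card ≤ e ∧ e ≤ T.card + 1} : Finset (Finset (Fin n))).image
        fun T => shellProj x l m (indicatorVec x T) : Finset (StdModule n)) :
          Set (StdModule n)) := by
  obtain ⟨d, hd⟩ : ∃ d, S.card + d = e := ⟨e - S.card, by omega⟩
  induction d using Nat.strong_induction_on generalizing S with
  | _ d ih =>
    by_cases h1 : e ≤ S.card + 1
    · refine Submodule.subset_span ?_
      rw [mem_coe, mem_image]
      exact ⟨S, by simp [hS, h1], rfl⟩
    · have hc : ((((n : ℝ) - l - S.card) * (n - m - S.card) : ℝ) : ℂ) ≠ 0 := by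
        rw [Complex.ofReal_ne_zero]
        have e1 : ((l + S.card : ℕ) : ℝ) < n := by exact_mod_cast (by omega)
        have e2 : ((m + S.card : ℕ) : ℝ) < n := by exact_mod_cast (by omega)
        push_cast at e1 e2
        exact mul_ne_zero (by linarith) (by linarith)
      rw [← Submodule.smul_mem_iff _ hc, shellProj_indicatorVec x hlm]
      have hins : ∀ j ∈ Sᶜ, (insert j S).card = S.card + 1 := fun j hj =>
        card_insert_of_notMem (by simpa using hj)
      refine Submodule.sub_mem _ (Submodule.smul_mem _ _ (Submodule.sum_mem _ fun j hj => ?_))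
        (Submodule.sum_mem _ fun j hj => Submodule.sum_mem _ fun j' hj' => ?_)
      · have h2 := hins j hj
        exact ih (d - 1) (by omega) _ (by omega) (by omega)
      · have h2 := hins j hj
        have h3 : (insert j' (insert j S)).card = S.card + 2 := by
          rw [card_insert_of_notMem (by simpa using hj'), h2]
        exact ih (d - 2) (by omega) _ (by omega) (by omega)

lemma sum_binomDiff (n e : ℕ) : ∑ r ∈ range (e + 1), binomDiff n r = n.choose e := by
  induction e with
  | zero => simp [binomDiff]
  | succ e ih =>
    rw [sum_range_succ, ih, binomDiff]
    simp

/-- There are `choose n e + choose n (e - 1)` sets of size `e` or `e - 1`; the right-hand side is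
this number as it occurs as the trace of the reproducing kernel. -/
lemma card_filter_levels (n e : ℕ) :
    ((({T | T.card ≤ e ∧ e ≤ T.card + 1} : Finset (Finset (Fin n))).card : ℕ) : ℝ) =
      2 * ∑ r ∈ range e, binomDiff n r + binomDiff n e := by
  have hlevel : ∀ j, (({T | T.card = j} : Finset (Finset (Fin n))).card : ℕ) = n.choose j := by
    intro j
    have := card_powersetCard j (univ : Finset (Fin n))
    rw [card_univ, Fintype.card_fin] at this
    rw [← this]
    congr 1
    ext T; simp [mem_powersetCard]
  cases e with
  | zero =>
    have : ({T | T.card ≤ 0 ∧ 0 ≤ T.card + 1} : Finset (Finset (Fin n))) =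
        ({T | T.card = 0} : Finset (Finset (Fin n))) := by
      ext T; simp
    rw [this, hlevel]; simp [binomDiff]
  | succ e =>
    have : ({T | T.card ≤ e + 1 ∧ e + 1 ≤ T.card + 1} : Finset (Finset (Fin n))) =
        ({T | T.card = e + 1} : Finset (Finset (Fin n))) ∪
        ({T | T.card = e} : Finset (Finset (Fin n))) := by
      ext T
      simp only [mem_filter, mem_univ, true_and, mem_union]
      omega
    rw [this, card_union_of_disjoint, hlevel, hlevel, sum_binomDiff, binomDiff]
    · simp; ring
    · rw [disjoint_left]
      intro T h1 h2
      simp only [mem_filter, mem_univ, true_and] at h1 h2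
      omega

/-- The functions of degree at most `e` on two shells have dimension at most
`choose n e + choose n (e - 1)`. -/
lemma finrank_le (x : Cube n) {l m e : ℕ} (hlm : l ≠ m) (hl : l + e ≤ n) (hm : m + e ≤ n) :
    (Module.finrank ℂ (Submodule.map (shellProj x l m)
      (⨆ i ∈ range (e + 1), eigSpace n i)) : ℝ) ≤
      2 * ∑ r ∈ range e, binomDiff n r + binomDiff n e := by
  classical
  rw [← card_filter_levels]
  have h1 : Submodule.map (shellProj x l m) (⨆ i ∈ range (e + 1), eigSpace n i) ≤
      Submodule.span ℂ
      ((({T | T.card ≤ e ∧ e ≤ T.card + 1} : Finset (Finset (Fin n))).image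
        fun T => shellProj x l m (indicatorVec x T) : Finset (StdModule n)) :
          Set (StdModule n)) := by
    refine (Submodule.map_mono (iSup_eigSpace_le x e)).trans ?_
    rw [Submodule.map_span, Submodule.span_le]
    rintro _ ⟨_, ⟨S, hS, rfl⟩, rfl⟩
    exact shellProj_indicatorVec_mem_span x hlm hl hm S hS
  have h2 := (Submodule.finrank_mono h1).trans (finrank_span_finset_le_card _)
  exact_mod_cast h2.trans card_image_le

end Dimension

/-- Tight relative designs, in terms of sets of coordinates. -/
lemma isTight {n e l m : ℕ} {x : Cube n} {Y : Finset (Cube n)} {ω : Cube n → ℝ}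
    (hY : IsTightRelativeDesign e x Y ω) (hL : shellIndices x Y = {l, m})
    (hel : e ≤ l) (hlm : l < m) (hmn : m + l ≤ n) :
    IsTight n e l m x Y fun y => ω y.1 where
  le_l := hel
  l_lt_m := hlm
  add_le := hmn
  pos := fun y => hY.1.1.1 y.1 y.2
  card_add := fun y => card_agreement_add x y.1
  shell := fun y => by
    have : hammingDist x y.1 ∈ shellIndices x Y := mem_image_of_mem _ y.2
    rw [hL] at this
    simpa using this
  nonempty_l := by
    have : l ∈ shellIndices x Y := by rw [hL]; simp
    obtain ⟨y, hy, h⟩ := mem_image.1 this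
    exact ⟨⟨y, hy⟩, h⟩
  nonempty_m := by
    have : m ∈ shellIndices x Y := by rw [hL]; simp
    obtain ⟨y, hy, h⟩ := mem_image.1 this
    exact ⟨⟨y, hy⟩, h⟩
  design := by
    obtain ⟨lam, hlam⟩ := exists_sum_mul_indicator hY.1
    refine ⟨lam, fun T hT => ?_⟩
    rw [← hlam T hT]
    rw [sum_coe_sort Y fun y => ω y * if T ⊆ agreement x y then (1:ℝ) else 0]
    refine sum_subset (subset_univ _) fun y _ hy => ?_
    rw [hY.1.1.2 y hy, zero_mul]
  injective := (agreement_injective x).comp Subtype.val_injective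
  card_le := by
    rw [Fintype.card_coe, hY.2, hL]
    exact finrank_le x hlm.ne (by omega) (by omega)

lemma totalWeight_eq {n : ℕ} {x : Cube n} {Y : Finset (Cube n)} {ω : Cube n → ℝ}
    (hY : IsWeightedSubset Y ω) (a : ℕ) :
    totalWeight (fun y : Y => hammingDist x y.1) (fun y : Y => ω y.1) a = shellWeight x ω a := by
  rw [totalWeight, shellWeight, sum_filter, sum_filter,
    sum_coe_sort Y fun y => if hammingDist x y = a then ω y else 0]
  refine sum_subset (subset_univ _) fun y _ hy => ?_
  rw [hY.2 y hy, ite_self]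

lemma adjacencySpan_pairRelations {n : ℕ} {x : Cube n} {Y : Finset (Cube n)} {l m : ℕ}
    (hL : shellIndices x Y = {l, m}) :
    adjacencySpan (pairRelations x Y) = blockSpan x Y l m := by
  have hblock : ∀ a b j, relationMatrix {p | pairType x Y p = (a, b, j)} =
      distBlock x Y a b j := by
    intro a b j
    ext y z
    simp only [relationMatrix, distBlock, distMatrix, Matrix.of_apply, pairType, Prod.mk.injEq,
      Set.mem_ofPred_eq, shellPart]
    by_cases h1 : hammingDist x y.1 = a <;> by_cases h2 : hammingDist x z.1 = b <;> simp [h1, h2]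
  rw [adjacencySpan, blockSpan]
  congr 1
  ext M
  constructor
  · rintro ⟨_, ⟨⟨y, z⟩, rfl⟩, rfl⟩
    have hmem : ∀ u : Y, hammingDist x u.1 ∈ ({l, m} : Set ℕ) := fun u => by
      have : hammingDist x u.1 ∈ shellIndices x Y := mem_image_of_mem _ u.2
      rw [hL] at this
      simpa using this
    exact ⟨_, hmem y, _, hmem z, _, mem_distSet.2 ⟨y, z, rfl, rfl, rfl⟩, hblock _ _ _⟩
  · rintro ⟨a, -, b, -, j, hj, rfl⟩
    obtain ⟨y, z, rfl, rfl, rfl⟩ := mem_distSet.1 hj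
    exact ⟨_, ⟨(y, z), rfl⟩, hblock _ _ _⟩

lemma zeroSet_psiDiag {n e l m : ℕ} {x : Cube n} {Y : Finset (Cube n)} {ω : Cube n → ℝ}
    (hY : IsWeightedSubset Y ω) (h : IsTight n e l m x Y fun y => ω y.1) (y : Y) :
    let P := psiDiag n e (hammingDist x y.1) (shellWeight x ω (hammingDist x y.1))
      (kappa n e l m (shellWeight x ω l) (shellWeight x ω m))
    P.natDegree = e ∧ zeroSet P = {ξ : ℂ | ξ ≠ 0 ∧
      ∃ j ∈ distSet x Y (hammingDist x y.1) (hammingDist x y.1), 2 * ξ = (j : ℂ)} := by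
  have h1 := h.degree_psiDiag y
  have h2 := (h.diag_zeros y).2
  simp only [totalWeight_eq hY] at h1 h2
  refine ⟨Polynomial.natDegree_eq_of_degree_eq_some h1, ?_⟩
  rw [h2]
  ext ξ
  simp only [Set.mem_ofPred_eq]
  constructor
  · rintro ⟨s, hs, rfl⟩
    refine ⟨fun h0 => ?_, 2 * s, (mem_distSet_self ⟨y, rfl⟩).2 (Or.inr ⟨s, hs, rfl⟩),
      by push_cast; rfl⟩
    have : s = 0 := by exact_mod_cast h0
    exact zero_notMem_cubeDiffSet_self h _ (this ▸ hs)
  · rintro ⟨h0, j, hj, hξ⟩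
    rcases (mem_distSet_self ⟨y, rfl⟩).1 hj with rfl | ⟨s, hs, rfl⟩
    · exact absurd (by simpa using hξ) h0
    · refine ⟨s, hs, ?_⟩
      push_cast at hξ
      exact mul_left_cancel₀ two_ne_zero hξ

lemma zeroSet_psiOff {n e l m : ℕ} {x : Cube n} {Y : Finset (Cube n)} {w : Y → ℝ}
    (h : IsTight n e l m x Y w) :
    (psiOff n e l m).natDegree = e ∧ zeroSet (psiOff n e l m) =
      {ξ : ℂ | ∃ s ∈ cubeDiffSet x Y l m, ξ = (s : ℂ)} := by
  have h1 := h.le_l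
  have h2 := h.l_lt_m
  have h3 := h.add_le
  refine ⟨Polynomial.natDegree_eq_of_degree_eq_some
    (degree_hahnPoly h1 (by omega) (by omega)), ?_⟩
  obtain ⟨y, hy⟩ := h.nonempty_l
  obtain ⟨z, hz⟩ := h.nonempty_m
  have h4 := (h.off_zeros (y₀ := y) (z₀ := z) (by omega)).2
  rw [hy, hz] at h4
  exact h4

end HypercubeDesign

open HypercubeDesign in
theorem mainTheorem1 (n e l m : ℕ) (x : Cube n) (Y : Finset (Cube n)) (ω : Cube n → ℝ)
    (hY : IsTightRelativeDesign e x Y ω) (hL : shellIndices x Y = {l, m})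
    (hel : e ≤ l) (hlm : l < m) (hmn : m + l ≤ n) :
    -- (i)
    (IsCoherentAlgebra (blockSpan x Y l m) ∧
      ∃ R : Set (Set (Y × Y)), IsCoherentConfiguration R ∧
        adjacencySpan R = blockSpan x Y l m ∧
        HasType R ![shellPart x Y l, shellPart x Y m] !![e + 1, e; e, e + 1]) ∧
    -- (ii)
    (∀ wl wm κ : ℝ, wl = shellWeight x ω l → wm = shellWeight x ω m → κ = kappa n e l m wl wm →
      ((psiDiag n e l wl κ).natDegree = e ∧ (psiDiag n e m wm κ).natDegree = e ∧
        (psiOff n e l m).natDegree = e) ∧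
      zeroSet (psiDiag n e l wl κ) =
        {ξ : ℂ | ξ ≠ 0 ∧ ∃ j ∈ distSet x Y l l, 2 * ξ = (j : ℂ)} ∧
      zeroSet (psiDiag n e m wm κ) =
        {ξ : ℂ | ξ ≠ 0 ∧ ∃ j ∈ distSet x Y m m, 2 * ξ = (j : ℂ)} ∧
      zeroSet (psiOff n e l m) =
        {ξ : ℂ | ∃ j ∈ distSet x Y l m, 2 * ξ + (m : ℂ) - (l : ℂ) = (j : ℂ)} ∧
      (∀ ξ ∈ zeroSet (psiDiag n e l wl κ) ∪ zeroSet (psiDiag n e m wm κ) ∪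
        zeroSet (psiOff n e l m), ∃ k : ℤ, ξ = (k : ℂ))) := by
  have h := isTight hY hL hel hlm hmn
  have hconf := isCoherentConfiguration h
  have hspan := adjacencySpan_pairRelations hL
  refine ⟨⟨hspan ▸ hconf.isCoherentAlgebra, _, hconf, hspan, hasType h⟩, ?_⟩
  rintro wl wm κ rfl rfl rfl
  obtain ⟨y, hy⟩ := h.nonempty_l
  obtain ⟨z, hz⟩ := h.nonempty_m
  obtain ⟨dl, zl⟩ := zeroSet_psiDiag hY.1.1 h y
  obtain ⟨dm, zm⟩ := zeroSet_psiDiag hY.1.1 h z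
  obtain ⟨dlm, zlm⟩ := zeroSet_psiOff h
  rw [hy] at dl zl
  rw [hz] at dm zm
  have even : ∀ (a : ℕ) (ξ : ℂ),
      (∃ j ∈ distSet x Y a a, 2 * ξ = (j : ℂ)) → ∃ k : ℤ, ξ = (k : ℂ) := by
    rintro a ξ ⟨j, hj, hξ⟩
    obtain ⟨u, v, hu, hv, rfl⟩ := mem_distSet.1 hj
    have := hammingDist_add x u.1 v.1
    rw [show hammingDist u.1 v.1 = 2 * (agreement x v.1 \ agreement x u.1).card by omega] at hξ
    refine ⟨(agreement x v.1 \ agreement x u.1).card, mul_left_cancel₀ two_ne_zero (hξ.trans ?_)⟩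
    push_cast; rfl
  refine ⟨⟨dl, dm, dlm⟩, zl, zm, ?_, ?_⟩
  · rw [zlm]
    ext ξ
    simp only [Set.mem_ofPred_eq]
    constructor
    · rintro ⟨s, hs, rfl⟩
      refine ⟨2 * s + m - l, (mem_distSet_of_ne hlm.ne).2 ⟨s, hs, by omega⟩, ?_⟩
      rw [Nat.cast_sub (by omega)]; push_cast; rfl
    · rintro ⟨j, hj, hξ⟩
      obtain ⟨s, hs, hj'⟩ := (mem_distSet_of_ne hlm.ne).1 hj
      refine ⟨s, hs, mul_left_cancel₀ (two_ne_zero (α := ℂ)) ?_⟩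
      have := congrArg (Nat.cast : ℕ → ℂ) hj'
      push_cast at this
      linear_combination hξ + this
  · rintro ξ ((hξ | hξ) | hξ)
    · rw [zl] at hξ
      exact even l ξ hξ.2
    · rw [zm] at hξ
      exact even m ξ hξ.2
    · rw [zlm] at hξ
      obtain ⟨s, -, rfl⟩ := hξ
      exact ⟨s, by simp⟩
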